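/- Theorem 1.5. For a finite graph $G$ and $\lambda>0$ let $\Omega$ be the set of independent sets of $G$, and let $\pi(X)=\lambda^{|X|}/\sum_{Y\in\Omega}\lambda^{|Y|}$, $X\in\Omega$, be the hard-core Gibbs distribution at fugacity $\lambda$. One step of the Glauber dynamics at fugacity $\lambda$ from $X\in\Omega$ chooses a uniformly random vertex $v$, sets $X'=X\cup\{v\}$ with probability $\lambda/(1+\lambda)$ and $X'=X\setminus\{v\}$ with probability $1/(1+\lambda)$, and moves to $X'$ if $X'\in\Omega$ and stays at $X$ otherwise. Simulated annealing along fugacities $0=\lambda_0<\lambda_1<\dots<\lambda_k=\lambda$ with step counts $T_1,\dots,T_k$ starts at $Y_0=\emptyset$, obtains $Y_i$ from $Y_{i-1}$ by $T_i$ steps of the Glauber dynamics at fugacity $\lambda_i$ for $i=1,\dots,k$, and outputs $Y_k$. There are a randomized algorithm $\mathcal A$ (a program of a unit-cost random-access machine with exact real arithmetic and comparisons, adjacency queries to the input graph, uniformly random choices from $\{0,\dots,m-1\}$, and coins with a computed real bias) and a polynomial $p$ in three variables such that for every $\varepsilon>0$ there is $C>0$ such that for every $\delta>0$ the following holds. Let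 $G$ be a $\Delta$-regular graph on $n\ge 1$ vertices with $\operatorname{girth}(G)\ge 6$ (acyclic graphs having infinite girth) and $\Delta\ge C\log(n/\delta)$, and let $0<\lambda\le(1-\varepsilon)e/\Delta$. Then, on input $(G,\lambda,\delta,\varepsilon)$, $\mathcal A$ always halts within $p(n,1/\varepsilon,\log^+(1/\delta))$ steps, where $\log^+x=\max(0,\log x)$; it outputs an independent set of $G$ whose law is exactly that of the output of simulated annealing for some increasing sequence of fugacities from $0$ to $\lambda$ and some step counts; and the total variation distance $\frac12\sum_{X\in\Omega}|\Pr(\text{output}=X)-\pi(X)|$ between this law and $\pi$ is at most $\delta$. -/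

import Mathlib

/-! ### The hard-core model -/

namespace HardCore

section Model

variable {V : Type} [Fintype V] [DecidableEq V]

/-- The set `Ω` of independent sets of `G`. -/
def IndepSets (G : SimpleGraph V) : Type :=
  {X : Finset V // G.IsIndepSet (X : Set V)}

noncomputable instance instFintypeIndepSets (G : SimpleGraph V) : Fintype (IndepSets G) :=
  haveI : Finite (IndepSets G) := inferInstanceAs (Finite {_X : Finset V // _})
  Fintype.ofFinite _

/-- The empty independent set. -/
def emptySet (G : SimpleGraph V) : IndepSets G := ⟨∅, by simp⟩

/-- The partition function `Z(G, lam) = ∑_{X ∈ Ω} lam ^ |X|`. -/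
noncomputable def partitionFunction (G : SimpleGraph V) (lam : ℝ) : ℝ :=
  ∑ X : IndepSets G, lam ^ X.1.card

/-- The Gibbs distribution `π(X) = lam ^ |X| / Z` on the independent sets. -/
noncomputable def gibbs (G : SimpleGraph V) (lam : ℝ) (X : IndepSets G) : ℝ :=
  lam ^ X.1.card / partitionFunction G lam

/-- Total variation distance of two distributions on a finite set. -/
noncomputable def tvDist {Ω : Type} [Fintype Ω] (μ ν : Ω → ℝ) : ℝ :=
  (1 / 2) * ∑ x, |μ x - ν x|

/-- A coin that shows `true` with probability `p` (truncated to `[0, 1]`). -/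
noncomputable def coin (p : ℝ) : PMF Bool :=
  PMF.ofFintype
    (fun b => cond b (ENNReal.ofReal (min p 1)) (1 - ENNReal.ofReal (min p 1)))
    (by simp)

open scoped Classical in
/-- The update of `X` at the vertex `v`: try to insert `v` (if `b`) or to delete it
(otherwise), and keep `X` if the result is not independent. -/
noncomputable def update (G : SimpleGraph V) (X : IndepSets G) (v : V) (b : Bool) :
    IndepSets G :=
  if h : G.IsIndepSet ((if b then insert v X.1 else X.1.erase v : Finset V) : Set V)
  then ⟨_, h⟩ else X

variable [Nonempty V]

/-- One step of the Glauber dynamics at fugacity `lam`: a uniformly random vertex is inserted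
with probability `lam / (1 + lam)` and deleted with probability `1 / (1 + lam)`. -/
noncomputable def glauberStep (G : SimpleGraph V) (lam : ℝ) (X : IndepSets G) :
    PMF (IndepSets G) :=
  (PMF.uniformOfFintype V).bind fun v =>
    (coin (lam / (1 + lam))).map fun b => update G X v b

/-- `T` steps of the Glauber dynamics at fugacity `lam`, started at `X`. -/
noncomputable def glauber (G : SimpleGraph V) (lam : ℝ) : ℕ → IndepSets G → PMF (IndepSets G)
  | 0, X => PMF.pure X
  | T + 1, X => (glauberStep G lam X).bind (glauber G lam T)

/-- The law of the state `Y_k` reached by simulated annealing: `Y_0 = ∅`, and `Y_i` is reached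
from `Y_{i-1}` by `T i` steps of the Glauber dynamics at fugacity `lam i`. -/
noncomputable def annealing (G : SimpleGraph V) (lam : ℕ → ℝ) (T : ℕ → ℕ) :
    ℕ → PMF (IndepSets G)
  | 0 => PMF.pure (emptySet G)
  | i + 1 => (annealing G lam T i).bind (glauber G (lam (i + 1)) (T (i + 1)))

end Model

end HardCore

/-! ### Randomized algorithms: a real random-access machine with unit-cost steps -/

namespace RealRAM

/-- The store: registers holding natural numbers, registers holding real numbers, and a memory
of natural numbers that is addressed indirectly. -/
structure Store where
  nat : ℕ → ℕ
  real : ℕ → ℝ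
  mem : ℕ → ℕ

/-- Elementary instructions. The arguments are numbers of registers, except for the constant `c`
in `const`. -/
inductive Instr where
  | const (r c : ℕ)
  | add (r a b : ℕ)
  | sub (r a b : ℕ)
  | load (r a : ℕ)
  | store (a r : ℕ)
  | ofNat (r a : ℕ)
  | radd (r a b : ℕ)
  | rsub (r a b : ℕ)
  | rmul (r a b : ℕ)
  | rdiv (r a b : ℕ)
  | edge (r u v : ℕ)
  | flip (r p : ℕ)
  | unif (r m : ℕ)

/-- Tests: comparison of two registers. -/
inductive Test where
  | natLt (a b : ℕ)
  | realLt (a b : ℕ)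

/-- Programs. -/
inductive Prog where
  | skip
  | instr (i : Instr)
  | seq (p q : Prog)
  | ite (t : Test) (p q : Prog)
  | loop (t : Test) (p : Prog)

/-- Write `x` into the natural number register `r`. -/
def Store.setNat (s : Store) (r x : ℕ) : Store :=
  { s with nat := Function.update s.nat r x }

/-- Write `x` into the real register `r`. -/
def Store.setReal (s : Store) (r : ℕ) (x : ℝ) : Store :=
  { s with real := Function.update s.real r x }

/-- Write `x` into the memory cell `a`. -/
def Store.setMem (s : Store) (a x : ℕ) : Store :=
  { s with mem := Function.update s.mem a x }

/-- A uniformly random element of `{0, …, m - 1}` (and `0` if `m = 0`). -/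
noncomputable def uniformBelow (m : ℕ) : PMF ℕ :=
  if h : (Finset.range m).Nonempty then PMF.uniformOfFinset (Finset.range m) h else PMF.pure 0

/-- Truth value of a test. -/
def Test.holds (s : Store) : Test → Prop
  | .natLt a b => s.nat a < s.nat b
  | .realLt a b => s.real a < s.real b

open scoped Classical in
/-- Effect of an elementary instruction. The relation `E` is the adjacency relation of the input
graph, on vertices numbered from `0`. -/
noncomputable def Instr.exec (E : ℕ → ℕ → Prop) (s : Store) : Instr → PMF Store
  | .const r c => PMF.pure (s.setNat r c)
  | .add r a b => PMF.pure (s.setNat r (s.nat a + s.nat b))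
  | .sub r a b => PMF.pure (s.setNat r (s.nat a - s.nat b))
  | .load r a => PMF.pure (s.setNat r (s.mem (s.nat a)))
  | .store a r => PMF.pure (s.setMem (s.nat a) (s.nat r))
  | .ofNat r a => PMF.pure (s.setReal r (s.nat a))
  | .radd r a b => PMF.pure (s.setReal r (s.real a + s.real b))
  | .rsub r a b => PMF.pure (s.setReal r (s.real a - s.real b))
  | .rmul r a b => PMF.pure (s.setReal r (s.real a * s.real b))
  | .rdiv r a b => PMF.pure (s.setReal r (s.real a / s.real b))
  | .edge r u v => PMF.pure (s.setNat r (if E (s.nat u) (s.nat v) then 1 else 0))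
  | .flip r p => (HardCore.coin (s.real p)).map fun b => s.setNat r (if b then 1 else 0)
  | .unif r m => (uniformBelow (s.nat m)).map fun x => s.setNat r x

/-- A configuration: the list of programs still to be executed, and the store. The machine has
halted when the list is empty. -/
abbrev Config := List Prog × Store

open scoped Classical in
/-- One step of the machine. -/
noncomputable def step (E : ℕ → ℕ → Prop) : Config → PMF Config
  | ([], s) => PMF.pure ([], s)
  | (.skip :: K, s) => PMF.pure (K, s)
  | (.instr i :: K, s) => (i.exec E s).map fun s' => (K, s')
  | (.seq p q :: K, s) => PMF.pure (p :: q :: K, s)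
  | (.ite t p q :: K, s) => PMF.pure ((if t.holds s then p else q) :: K, s)
  | (.loop t p :: K, s) => PMF.pure (if t.holds s then p :: .loop t p :: K else K, s)

/-- Distribution of the configuration after `t` steps. -/
noncomputable def run (E : ℕ → ℕ → Prop) : ℕ → Config → PMF Config
  | 0, c => PMF.pure c
  | t + 1, c => (step E c).bind (run E t)

/-- The adjacency relation of a graph on `Fin n` as a relation on natural numbers. -/
def edges {n : ℕ} (G : SimpleGraph (Fin n)) (u v : ℕ) : Prop :=
  ∃ (hu : u < n) (hv : v < n), G.Adj ⟨u, hu⟩ ⟨v, hv⟩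

/-- The initial store: `n` is in the first natural number register, the inputs `x, y, z` are in
the first three real registers, and everything else is zero. -/
def initStore (n : ℕ) (x y z : ℝ) : Store where
  nat := fun r => if r = 0 then n else 0
  real := fun r => if r = 0 then x else if r = 1 then y else if r = 2 then z else 0
  mem := fun _ => 0

/-- The output of a halted machine: the set of the vertices `v` with `mem v ≠ 0`. There is no
output before the machine has halted. -/
def output (n : ℕ) : Config → Option (Finset (Fin n))
  | ([], s) => some (Finset.univ.filter fun v : Fin n => s.mem v ≠ 0)
  | (_ :: _, _) => none

/-- The distribution of the output of the program `P` after `t` steps, when the input is the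
graph `G` together with the real numbers `x, y, z`. -/
noncomputable def outputAfter (P : Prog) (t : ℕ) {n : ℕ} (G : SimpleGraph (Fin n))
    (x y z : ℝ) : PMF (Option (Finset (Fin n))) :=
  (run (edges G) t ([P], initStore n x y z)).map (output n)

end RealRAM

/-!
For `lam * Δ` below `e` the map `x ↦ c * exp (-x)` has no two-cycle, with a uniform gap, and this
forces local uniformity: under the Gibbs distribution, and hence under every law of bounded density
with respect to it, with high probability each vertex has about the same number `x / lam` of
unblocked neighbours, where `x` solves the fixed point equation `x = lam * Δ * exp (-x)`, so that
`x ≤ 1 - ε / 4`. Girth six makes the events at distinct neighbours of a vertex conditionally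
independent, which gives the concentration by Chernoff's bound.

At such sets the identical coupling of two Glauber chains contracts the Hamming distance. If one
chain is stationary and the other has a warm start, then both stay warm, so both avoid the atypical
sets, and the chains are close after `O(n log n)` steps. The Gibbs distribution at fugacity
`i * lam / k` is a warm start for the one at `(i + 1) * lam / k` as soon as `lam * n ≤ k`. This is
why annealing in `3 * n` stages succeeds although a cold start need not.
-/

namespace HardCore

open scoped NNReal

section Expectation

variable {α β : Type} [Fintype α]

/-- Expectation of a real function under a distribution on a finite type. -/
noncomputable def expect (μ : PMF α) (f : α → ℝ) : ℝ := ∑ x, (μ x).toReal * f x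

lemma sum_toReal (μ : PMF α) : ∑ x, (μ x).toReal = 1 := by
  rw [← ENNReal.toReal_sum (fun x _ => μ.apply_ne_top x), ← tsum_fintype (L := .unconditional _),
    μ.tsum_coe, ENNReal.toReal_one]

lemma expect_pure (a : α) (f : α → ℝ) : expect (PMF.pure a) f = f a := by
  classical
  rw [expect, Fintype.sum_eq_single a fun b hb => by simp [PMF.pure_apply, hb]]
  simp

lemma toReal_bind_apply (μ : PMF α) (κ : α → PMF β) (y : β) :
    (μ.bind κ y).toReal = expect μ fun x => (κ x y).toReal := by
  rw [PMF.bind_apply, tsum_fintype, ENNReal.toReal_sum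
    fun x _ => ENNReal.mul_ne_top (μ.apply_ne_top x) ((κ x).apply_ne_top y)]
  simp only [expect, ENNReal.toReal_mul]

lemma toReal_map_apply [DecidableEq β] (μ : PMF α) (g : α → β) (y : β) :
    (μ.map g y).toReal = expect μ fun x => if g x = y then 1 else 0 := by
  rw [← PMF.bind_pure_comp, toReal_bind_apply]
  simp only [Function.comp_apply, PMF.pure_apply, eq_comm (a := y), apply_ite ENNReal.toReal,
    ENNReal.toReal_one, ENNReal.toReal_zero]

variable [Fintype β] in
lemma expect_bind (μ : PMF α) (κ : α → PMF β) (f : β → ℝ) :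
    expect (μ.bind κ) f = expect μ fun x => expect (κ x) f := by
  simp only [expect, toReal_bind_apply, Finset.mul_sum, Finset.sum_mul]
  rw [Finset.sum_comm]
  simp only [mul_assoc]

variable [Fintype β] in
lemma expect_map (μ : PMF α) (g : α → β) (f : β → ℝ) :
    expect (μ.map g) f = expect μ fun x => f (g x) := by
  simp only [← PMF.bind_pure_comp, expect_bind, Function.comp_apply, expect_pure]

lemma expect_mono (μ : PMF α) {f g : α → ℝ} (h : ∀ x, f x ≤ g x) : expect μ f ≤ expect μ g :=
  Finset.sum_le_sum fun x _ => mul_le_mul_of_nonneg_left (h x) ENNReal.toReal_nonneg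

lemma expect_const (μ : PMF α) (c : ℝ) : expect μ (fun _ => c) = c := by
  rw [expect, ← Finset.sum_mul, sum_toReal, one_mul]

lemma expect_le_of_forall_le (μ : PMF α) {f : α → ℝ} {c : ℝ} (h : ∀ x, f x ≤ c) :
    expect μ f ≤ c :=
  (expect_mono μ h).trans_eq (expect_const μ c)

lemma expect_nonneg (μ : PMF α) {f : α → ℝ} (h : ∀ x, 0 ≤ f x) : 0 ≤ expect μ f :=
  Finset.sum_nonneg fun x _ => mul_nonneg ENNReal.toReal_nonneg (h x)

lemma expect_add (μ : PMF α) (f g : α → ℝ) :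
    expect μ (fun x => f x + g x) = expect μ f + expect μ g := by
  simp [expect, mul_add, Finset.sum_add_distrib]

lemma expect_sub (μ : PMF α) (f g : α → ℝ) :
    expect μ (fun x => f x - g x) = expect μ f - expect μ g := by
  simp [expect, mul_sub, Finset.sum_sub_distrib]

lemma expect_mul_left (μ : PMF α) (c : ℝ) (f : α → ℝ) :
    expect μ (fun x => c * f x) = c * expect μ f := by
  simp only [expect, Finset.mul_sum, mul_left_comm]

lemma expect_sum {ι : Type} (μ : PMF α) (s : Finset ι) (f : ι → α → ℝ) :
    expect μ (fun x => ∑ i ∈ s, f i x) = ∑ i ∈ s, expect μ (f i) := by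
  simp only [expect, Finset.mul_sum]
  exact Finset.sum_comm

lemma abs_expect_le (μ : PMF α) (f : α → ℝ) : |expect μ f| ≤ expect μ fun x => |f x| :=
  (Finset.abs_sum_le_sum_abs _ _).trans_eq <| by
    simp only [expect, abs_mul, abs_of_nonneg ENNReal.toReal_nonneg]

lemma ext_of_expect {μ ν : PMF α} (h : ∀ f, expect μ f = expect ν f) : μ = ν := by
  classical
  ext x
  rw [← ENNReal.toReal_eq_toReal_iff' (μ.apply_ne_top x) (ν.apply_ne_top x)]
  simpa [expect] using h fun y => if y = x then 1 else 0

lemma expect_uniform [Nonempty α] (f : α → ℝ) :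
    expect (PMF.uniformOfFintype α) f = (1 / (Fintype.card α : ℝ)) * ∑ x, f x := by
  simp [expect, Finset.mul_sum]

lemma expect_coin {p : ℝ} (h0 : 0 ≤ p) (h1 : p ≤ 1) (f : Bool → ℝ) :
    expect (coin p) f = p * f true + (1 - p) * f false := by
  simp only [expect, coin, Fintype.sum_bool, PMF.ofFintype_apply, cond_true, cond_false,
    min_eq_left h1]
  rw [ENNReal.toReal_sub_of_le (by simpa using h1) (by simp), ENNReal.toReal_ofReal h0,
    ENNReal.toReal_one]

end Expectation

section Probability

variable {α : Type} [Fintype α]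

/-- Probability of an event under a distribution on a finite type. -/
noncomputable def prob (μ : PMF α) (A : Set α) : ℝ := expect μ (A.indicator 1)

lemma prob_mono (μ : PMF α) {A B : Set α} (h : A ⊆ B) : prob μ A ≤ prob μ B :=
  expect_mono μ fun x => Set.indicator_le_indicator_of_subset h (fun _ => zero_le_one) x

lemma prob_union_le (μ : PMF α) (A B : Set α) : prob μ (A ∪ B) ≤ prob μ A + prob μ B := by
  rw [prob, prob, prob, ← expect_add]
  refine expect_mono μ fun x => ?_
  have h := Set.indicator_union_add_inter_apply (1 : α → ℝ) A B x
  linarith [Set.indicator_nonneg (s := A ∩ B) (f := (1 : α → ℝ)) (fun _ _ => zero_le_one) x]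

lemma prob_iUnion_le {ι : Type} [Fintype ι] (μ : PMF α) (A : ι → Set α) :
    prob μ (⋃ i, A i) ≤ ∑ i, prob μ (A i) := by
  simp only [prob]
  rw [← expect_sum]
  refine expect_mono μ fun x => ?_
  have h0 : ∀ i, 0 ≤ (A i).indicator (1 : α → ℝ) x := fun i =>
    Set.indicator_nonneg (fun _ _ => zero_le_one) x
  refine Set.indicator_apply_le' (fun hx => ?_) fun _ => Finset.sum_nonneg fun i _ => h0 i
  obtain ⟨i, hi⟩ := Set.mem_iUnion.mp hx
  exact (Set.indicator_of_mem hi (1 : α → ℝ)).ge.trans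
    (Finset.single_le_sum (fun i _ => h0 i) (Finset.mem_univ i))

/-- Chernoff's bound, with the parameter of the exponential absorbed in `f`. -/
lemma prob_lt_le (μ : PMF α) (f : α → ℝ) (a : ℝ) :
    prob μ {x | a < f x} ≤ Real.exp (-a) * expect μ fun x => Real.exp (f x) := by
  rw [← expect_mul_left]
  refine expect_mono μ fun x => Set.indicator_apply_le' (fun hx => ?_) fun _ => by positivity
  rw [← Real.exp_add]
  exact Real.one_le_exp (by linarith [Set.mem_ofPred_eq.mp hx])

end Probability

section WarmStart

variable {α : Type}

/-- `μ` is an `M`-warm start for `π`: the density of `μ` with respect to `π` is at most `M`. -/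
def IsWarm (M : ℝ≥0) (μ π : PMF α) : Prop := ∀ x, μ x ≤ M * π x

lemma IsWarm.bind {M : ℝ≥0} {μ π : PMF α} (h : IsWarm M μ π) (κ : α → PMF α) :
    IsWarm M (μ.bind κ) (π.bind κ) := fun x => by
  rw [PMF.bind_apply, PMF.bind_apply, ← ENNReal.tsum_mul_left]
  exact ENNReal.tsum_le_tsum fun y => (mul_le_mul_left (h y) _).trans_eq (mul_assoc _ _ _)

lemma IsWarm.iterate_bind {M : ℝ≥0} {μ π : PMF α} (h : IsWarm M μ π) {κ : α → PMF α}
    (hπ : π.bind κ = π) (t : ℕ) : IsWarm M ((·.bind κ)^[t] μ) π := by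
  induction t with
  | zero => exact h
  | succ t ih =>
    rw [Function.iterate_succ_apply']
    exact hπ ▸ ih.bind κ

lemma IsWarm.expect_le [Fintype α] {M : ℝ≥0} {μ π : PMF α} (h : IsWarm M μ π) {f : α → ℝ}
    (hf : ∀ x, 0 ≤ f x) : expect μ f ≤ M * expect π f := by
  rw [expect, expect, Finset.mul_sum]
  refine Finset.sum_le_sum fun x _ => ?_
  rw [← mul_assoc]
  refine mul_le_mul_of_nonneg_right ?_ (hf x)
  simpa using ENNReal.toReal_mono
    (ENNReal.mul_ne_top ENNReal.coe_ne_top (π.apply_ne_top x)) (h x)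

end WarmStart

section TotalVariation

variable {α β : Type} [Fintype α] [Fintype β]

/-- Total variation distance of two distributions on a finite type. -/
noncomputable def dTV (μ ν : PMF α) : ℝ :=
  tvDist (fun x => (μ x).toReal) fun x => (ν x).toReal

lemma dTV_self (μ : PMF α) : dTV μ μ = 0 := by simp [dTV, tvDist]

lemma dTV_triangle (μ ν ρ : PMF α) : dTV μ ρ ≤ dTV μ ν + dTV ν ρ := by
  simp only [dTV, tvDist]
  rw [← mul_add, ← Finset.sum_add_distrib]
  gcongr
  exact abs_sub_le _ _ _

lemma dTV_le_one (μ ν : PMF α) : dTV μ ν ≤ 1 := by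
  have h : ∑ x, |(μ x).toReal - (ν x).toReal| ≤ ∑ x, ((μ x).toReal + (ν x).toReal) :=
    Finset.sum_le_sum fun x _ => (abs_sub _ _).trans_eq <| by
      simp only [abs_of_nonneg ENNReal.toReal_nonneg]
  rw [Finset.sum_add_distrib, sum_toReal, sum_toReal] at h
  rw [dTV, tvDist]
  linarith

lemma dTV_bind_le (μ ν : PMF α) (κ : α → PMF β) : dTV (μ.bind κ) (ν.bind κ) ≤ dTV μ ν := by
  simp only [dTV, tvDist, toReal_bind_apply]
  refine mul_le_mul_of_nonneg_left ?_ (by norm_num)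
  calc ∑ y, |expect μ (fun x => (κ x y).toReal) - expect ν fun x => (κ x y).toReal|
      ≤ ∑ y, ∑ x, |(μ x).toReal - (ν x).toReal| * (κ x y).toReal := by
        refine Finset.sum_le_sum fun y _ => ?_
        rw [expect, expect, ← Finset.sum_sub_distrib]
        refine (Finset.abs_sum_le_sum_abs _ _).trans_eq (Finset.sum_congr rfl fun x _ => ?_)
        rw [← sub_mul, abs_mul, abs_of_nonneg (ENNReal.toReal_nonneg (a := κ x y))]
    _ = ∑ x, |(μ x).toReal - (ν x).toReal| := by
        rw [Finset.sum_comm]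
        simp only [← Finset.mul_sum, sum_toReal, mul_one]

lemma dTV_map_le_expect (J : PMF α) {f g : α → β} {d : α → ℝ} (h0 : ∀ x, 0 ≤ d x)
    (h1 : ∀ x, f x ≠ g x → 1 ≤ d x) : dTV (J.map f) (J.map g) ≤ expect J d := by
  classical
  have hind : ∀ x, ∑ y, |(if f x = y then (1 : ℝ) else 0) - if g x = y then 1 else 0| ≤
      2 * d x := fun x => by
    by_cases hx : f x = g x
    · simpa [hx] using h0 x
    · calc _ ≤ ∑ y, ((if f x = y then (1 : ℝ) else 0) + if g x = y then 1 else 0) :=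
            Finset.sum_le_sum fun y _ => by split_ifs <;> norm_num
        _ ≤ 2 * d x := by
            rw [Finset.sum_add_distrib]
            simp only [Finset.sum_ite_eq, Finset.mem_univ, if_true]
            linarith [h1 x hx]
  have hsum : ∑ y, |(J.map f y).toReal - (J.map g y).toReal| ≤ 2 * expect J d := by
    simp only [toReal_map_apply, ← expect_sub]
    rw [← expect_mul_left]
    refine (Finset.sum_le_sum fun y _ => abs_expect_le J _).trans ?_
    rw [← expect_sum]
    exact expect_mono J hind
  rw [dTV, tvDist]
  linarith

end TotalVariation

section Coupling

variable {α : Type}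

lemma le_of_affine_recursion {e : ℕ → ℝ} {r c D : ℝ} (hr0 : 0 ≤ r) (hr1 : r < 1) (hc : 0 ≤ c)
    (h0 : e 0 ≤ D) (h : ∀ t, e (t + 1) ≤ r * e t + c) (t : ℕ) :
    e t ≤ D * r ^ t + c / (1 - r) := by
  have hr : 0 < 1 - r := by linarith
  induction t with
  | zero =>
    have : 0 ≤ c / (1 - r) := by positivity
    linarith
  | succ t ih =>
    calc e (t + 1) ≤ r * (D * r ^ t + c / (1 - r)) + c :=
          (h t).trans (by gcongr)
      _ = D * r ^ (t + 1) + c / (1 - r) := by field_simp; ring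

/-- `Q` is a coupling of two copies of the Markov kernel `κ`. -/
structure IsCoupling (Q : α × α → PMF (α × α)) (κ : α → PMF α) : Prop where
  map_fst : ∀ p, (Q p).map Prod.fst = κ p.1
  map_snd : ∀ p, (Q p).map Prod.snd = κ p.2

variable {Q : α × α → PMF (α × α)} {κ : α → PMF α}

lemma IsCoupling.map_fst_iterate (hQ : IsCoupling Q κ) (J : PMF (α × α)) (t : ℕ) :
    ((·.bind Q)^[t] J).map Prod.fst = (·.bind κ)^[t] (J.map Prod.fst) := by
  have h : Function.Semiconj (PMF.map Prod.fst) (·.bind Q) (·.bind κ) := fun J => by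
    simp only [PMF.map_bind, PMF.bind_map, Function.comp_def, hQ.map_fst]
  exact h.iterate_right t J

lemma IsCoupling.map_snd_iterate (hQ : IsCoupling Q κ) (J : PMF (α × α)) (t : ℕ) :
    ((·.bind Q)^[t] J).map Prod.snd = (·.bind κ)^[t] (J.map Prod.snd) := by
  have h : Function.Semiconj (PMF.map Prod.snd) (·.bind Q) (·.bind κ) := fun J => by
    simp only [PMF.map_bind, PMF.bind_map, Function.comp_def, hQ.map_snd]
  exact h.iterate_right t J

/-- The product distribution, i.e. the law of a pair of independent samples of `μ` and `ν`. -/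
noncomputable def indepPair (μ ν : PMF α) : PMF (α × α) := μ.bind fun x => ν.map (Prod.mk x)

lemma indepPair_map_fst (μ ν : PMF α) : (indepPair μ ν).map Prod.fst = μ := by
  have h : ∀ x : α, (ν.map (Prod.mk x)).map Prod.fst = PMF.pure x := fun x => by
    rw [PMF.map_comp]
    exact PMF.map_const ν x
  simp only [indepPair, PMF.map_bind, h, PMF.bind_pure]

lemma indepPair_map_snd (μ ν : PMF α) : (indepPair μ ν).map Prod.snd = ν := by
  have h : ∀ x : α, (ν.map (Prod.mk x)).map Prod.snd = ν := fun x => by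
    rw [PMF.map_comp]
    exact ν.map_id
  simp only [indepPair, PMF.map_bind, h, PMF.bind_const]

variable [Fintype α]

lemma expect_coupling_le {d : α × α → ℝ} {B : Set α} {r D : ℝ} (hr : 0 ≤ r) (hd0 : ∀ p, 0 ≤ d p)
    (hdD : ∀ p, d p ≤ D)
    (hcontract : ∀ x z, x ∉ B → z ∉ B → expect (Q (x, z)) d ≤ r * d (x, z)) (p : α × α) :
    expect (Q p) d ≤ r * d p + D * (B.indicator 1 p.1 + B.indicator 1 p.2) := by
  obtain ⟨x, z⟩ := p
  have hD : 0 ≤ D := (hd0 _).trans (hdD (x, z))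
  have hrd : 0 ≤ r * d (x, z) := mul_nonneg hr (hd0 _)
  have hE : expect (Q (x, z)) d ≤ D := expect_le_of_forall_le _ hdD
  by_cases hx : x ∈ B <;> by_cases hz : z ∈ B
  · simp only [hx, hz, Set.indicator_of_mem, Pi.one_apply]
    linarith
  · simp only [hx, hz, Set.indicator_of_mem, Pi.one_apply, not_false_eq_true,
      Set.indicator_of_notMem]
    linarith
  · simp only [hx, hz, Set.indicator_of_mem, Pi.one_apply, not_false_eq_true,
      Set.indicator_of_notMem]
    linarith
  · simpa [hx, hz] using hcontract x z hx hz

/-- A chain that is started warm stays warm, so it avoids a set `B` that is unlikely under `π`;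
outside `B` the coupling with the stationary chain contracts. -/
theorem dTV_iterate_le_of_contraction (hQ : IsCoupling Q κ) {d : α × α → ℝ} {B : Set α}
    {r D : ℝ} {M : ℝ≥0} (hr0 : 0 ≤ r) (hr1 : r < 1) (hd0 : ∀ p, 0 ≤ d p)
    (hd1 : ∀ p : α × α, p.1 ≠ p.2 → 1 ≤ d p) (hdD : ∀ p, d p ≤ D)
    (hcontract : ∀ x z, x ∉ B → z ∉ B → expect (Q (x, z)) d ≤ r * d (x, z))
    {μ π : PMF α} (hwarm : IsWarm M μ π) (hπ : π.bind κ = π) (T : ℕ) :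
    dTV ((·.bind κ)^[T] μ) π ≤ D * r ^ T + D * ((M + 1) * prob π B) / (1 - r) := by
  set J : ℕ → PMF (α × α) := fun t => (·.bind Q)^[t] (indepPair μ π)
  have hfst : ∀ t, (J t).map Prod.fst = (·.bind κ)^[t] μ := fun t => by
    rw [hQ.map_fst_iterate, indepPair_map_fst]
  have hsnd : ∀ t, (J t).map Prod.snd = π := fun t => by
    rw [hQ.map_snd_iterate, indepPair_map_snd]
    exact Function.iterate_fixed hπ t
  have hB : ∀ t, expect (J t) (fun p => B.indicator 1 p.1 + B.indicator 1 p.2) ≤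
      (M + 1) * prob π B := fun t => by
    rw [expect_add, ← expect_map (J t) Prod.fst, ← expect_map (J t) Prod.snd, hfst, hsnd]
    have hw : expect _ (B.indicator 1) ≤ M * prob π B :=
      (hwarm.iterate_bind hπ t).expect_le fun x =>
        Set.indicator_nonneg (fun _ _ => zero_le_one) x
    rw [add_one_mul]
    exact add_le_add hw le_rfl
  have hD : 0 ≤ D := (expect_nonneg (J 0) hd0).trans (expect_le_of_forall_le (J 0) hdD)
  have hrec : ∀ t, expect (J (t + 1)) d ≤ r * expect (J t) d + D * ((M + 1) * prob π B) :=
    fun t => by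
      have hJ : J (t + 1) = (J t).bind Q := Function.iterate_succ_apply' _ _ _
      rw [hJ, expect_bind]
      refine (expect_mono _ (expect_coupling_le hr0 hd0 hdD hcontract)).trans ?_
      rw [expect_add, expect_mul_left, expect_mul_left]
      gcongr
      exact hB t
  have hc : 0 ≤ D * ((M + 1) * prob π B) := mul_nonneg hD <|
    (expect_nonneg (J 0) fun p => add_nonneg
      (Set.indicator_nonneg (fun _ _ => zero_le_one) _)
      (Set.indicator_nonneg (fun _ _ => zero_le_one) _)).trans (hB 0)
  calc dTV ((·.bind κ)^[T] μ) π = dTV ((J T).map Prod.fst) ((J T).map Prod.snd) := by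
        rw [hfst, hsnd]
    _ ≤ expect (J T) d := dTV_map_le_expect _ hd0 hd1
    _ ≤ _ := le_of_affine_recursion (e := fun t => expect (J t) d) hr0 hr1 hc
        (expect_le_of_forall_le (J 0) hdD) hrec T

end Coupling

section Chain

variable {α : Type}

/-- Law of a time-inhomogeneous Markov chain started at `a`, with kernel `κ m` at time `m`. -/
noncomputable def chain (κ : ℕ → α → PMF α) (a : α) : ℕ → PMF α
  | 0 => PMF.pure a
  | m + 1 => (chain κ a m).bind (κ m)

lemma chain_const_succ (κ : α → PMF α) (a : α) (T : ℕ) :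
    chain (fun _ => κ) a (T + 1) = (κ a).bind fun b => chain (fun _ => κ) b T := by
  induction T with
  | zero => simp [chain, PMF.bind_pure]
  | succ T ih => rw [chain, ih, PMF.bind_bind]; rfl

lemma bind_chain_const (κ : α → PMF α) (μ : PMF α) (T : ℕ) :
    (μ.bind fun a => chain (fun _ => κ) a T) = (·.bind κ)^[T] μ := by
  induction T with
  | zero => simp [chain, PMF.bind_pure]
  | succ T ih => rw [Function.iterate_succ_apply', ← ih, PMF.bind_bind]; rfl

variable {V : Type} [Fintype V] [DecidableEq V] [Nonempty V]

lemma glauber_eq_chain (G : SimpleGraph V) (lam : ℝ) (T : ℕ) (X : IndepSets G) :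
    glauber G lam T X = chain (fun _ => glauberStep G lam) X T := by
  induction T generalizing X with
  | zero => rfl
  | succ T ih => rw [glauber, funext ih, chain_const_succ]

lemma bind_glauber (G : SimpleGraph V) (lam : ℝ) (T : ℕ) (μ : PMF (IndepSets G)) :
    μ.bind (glauber G lam T) = (·.bind (glauberStep G lam))^[T] μ := by
  rw [funext (glauber_eq_chain G lam T), bind_chain_const]

lemma annealing_eq_chain (G : SimpleGraph V) (fug : ℕ → ℝ) (T : ℕ → ℕ) (k : ℕ) :
    annealing G fug T k =
      chain (fun i => glauber G (fug (i + 1)) (T (i + 1))) (emptySet G) k := by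
  induction k with
  | zero => rfl
  | succ k ih => rw [annealing, ih, chain]

end Chain

section Update

variable {V : Type} {G : SimpleGraph V}

variable (G) in
/-- The vertex `w` has no neighbour in `X`, i.e. it is not blocked by `X`. -/
def Free (X : Finset V) (w : V) : Prop := ∀ u ∈ X, ¬ G.Adj w u

variable [DecidableEq V]

lemma free_union_iff {Y R : Finset V} {x : V} (h : ∀ u ∈ R, ¬ G.Adj x u) :
    Free G (Y ∪ R) x ↔ Free G Y x := by
  simp only [Free, Finset.mem_union, or_imp, forall_and, and_iff_left h]

lemma isIndepSet_union {Y R : Finset V} (hY : G.IsIndepSet (Y : Set V))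
    (hR : G.IsIndepSet (R : Set V)) (h : ∀ x ∈ R, Free G Y x) :
    G.IsIndepSet ((Y ∪ R : Finset V) : Set V) := by
  intro a ha b hb hab
  simp only [Finset.coe_union, Set.mem_union, Finset.mem_coe] at ha hb
  rcases ha with ha | ha <;> rcases hb with hb | hb
  · exact hY ha hb hab
  · exact fun hadj => h b hb a ha hadj.symm
  · exact h a ha b hb
  · exact hR ha hb hab

lemma isIndepSet_insert_iff {X : Finset V} (hX : G.IsIndepSet (X : Set V)) (v : V) :
    G.IsIndepSet ((insert v X : Finset V) : Set V) ↔ Free G X v := by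
  refine ⟨fun h u hu hadj => h (by simp) (by simp [hu]) hadj.ne hadj, fun h => ?_⟩
  rw [← Finset.union_singleton]
  exact isIndepSet_union hX (by simp) (by simpa using h)

lemma update_false_val (X : IndepSets G) (v : V) : (update G X v false).1 = X.1.erase v := by
  have h : G.IsIndepSet ((X.1.erase v : Finset V) : Set V) :=
    Set.Pairwise.mono (by simp) X.2
  exact congrArg Subtype.val (dif_pos h : update G X v false = ⟨_, h⟩)

open scoped Classical in
lemma update_true_val (X : IndepSets G) (v : V) :
    (update G X v true).1 = if Free G X.1 v then insert v X.1 else X.1 := by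
  split_ifs with hfree
  · have h := (isIndepSet_insert_iff X.2 v).mpr hfree
    exact congrArg Subtype.val (dif_pos h : update G X v true = ⟨_, h⟩)
  · have h := mt (isIndepSet_insert_iff X.2 v).mp hfree
    exact congrArg Subtype.val (dif_neg h : update G X v true = X)

lemma mem_update (X : IndepSets G) (v u : V) (b : Bool) :
    u ∈ (update G X v b).1 ↔ if u = v then b = true ∧ Free G X.1 v else u ∈ X.1 := by
  cases b
  · rw [update_false_val]
    by_cases huv : u = v <;> simp [huv]
  · have hv : v ∈ X.1 → Free G X.1 v := fun hv w hw hadj => X.2 hv hw hadj.ne hadj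
    rw [update_true_val]
    by_cases huv : u = v <;> by_cases hfree : Free G X.1 v <;> simp [huv, hfree, mt hv]

end Update

section IndepSum

variable {V : Type} [Fintype V] (G : SimpleGraph V)

open scoped Classical in
/-- Sum over the independent sets, of a function that is defined on all sets of vertices. -/
noncomputable def indepSum (f : Finset V → ℝ) : ℝ :=
  ∑ X ∈ Finset.univ.filter (fun X : Finset V => G.IsIndepSet (X : Set V)), f X

variable {G}

lemma sum_val_eq_indepSum (f : Finset V → ℝ) : ∑ X : IndepSets G, f X.1 = indepSum G f := by
  classical
  exact Finset.sum_bij (fun X _ => X.1) (fun X _ => by simpa using X.2)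
    (fun X _ Y _ h => Subtype.ext h)
    (fun X hX => ⟨⟨X, by simpa using hX⟩, Finset.mem_univ _, rfl⟩) fun _ _ => rfl

lemma indepSum_mono {f g : Finset V → ℝ} (h : ∀ X, f X ≤ g X) : indepSum G f ≤ indepSum G g :=
  Finset.sum_le_sum fun X _ => h X

lemma mul_indepSum (c : ℝ) (f : Finset V → ℝ) :
    c * indepSum G f = indepSum G fun X => c * f X :=
  Finset.mul_sum _ _ _

variable [DecidableEq V]

open scoped Classical in
/-- Independent sets are chosen in two rounds: first outside an independent set `S`, and then
among the vertices of `S` that are still free. -/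
lemma indepSum_split {S : Finset V} (hS : G.IsIndepSet (S : Set V)) (f : Finset V → ℝ) :
    indepSum G f = indepSum G fun Y =>
      if Disjoint Y S then ∑ R ∈ (S.filter (Free G Y)).powerset, f (Y ∪ R) else 0 := by
  unfold indepSum
  rw [← Finset.sum_filter, Finset.filter_filter, Finset.sum_sigma']
  refine Finset.sum_bij' (fun X _ => ⟨X \ S, X ∩ S⟩) (fun p _ => p.1 ∪ p.2) ?_ ?_
    (fun X _ => Finset.sdiff_union_inter X S) ?_
    (fun X _ => congrArg f (Finset.sdiff_union_inter X S).symm)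
  · intro X hX
    have hX : G.IsIndepSet (X : Set V) := by simpa using hX
    simp only [Finset.mem_sigma, Finset.mem_filter, Finset.mem_univ, true_and,
      Finset.mem_powerset]
    refine ⟨⟨hX.mono (by simp), Finset.sdiff_disjoint⟩, fun x hx => ?_⟩
    obtain ⟨hxX, hxS⟩ := Finset.mem_inter.mp hx
    exact Finset.mem_filter.mpr ⟨hxS, fun u hu hadj =>
      hX hxX (Finset.mem_sdiff.mp hu).1 hadj.ne hadj⟩
  · rintro ⟨Y, R⟩ hp
    simp only [Finset.mem_sigma, Finset.mem_filter, Finset.mem_univ, true_and,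
      Finset.mem_powerset] at hp ⊢
    exact isIndepSet_union hp.1.1 (hS.mono fun x hx => (Finset.mem_filter.mp (hp.2 hx)).1)
      fun x hx => (Finset.mem_filter.mp (hp.2 hx)).2
  · rintro ⟨Y, R⟩ hp
    simp only [Finset.mem_sigma, Finset.mem_filter, Finset.mem_univ, true_and,
      Finset.mem_powerset] at hp
    have hRS : R ⊆ S := hp.2.trans (Finset.filter_subset _ _)
    have hsdiff : (Y ∪ R) \ S = Y := by
      rw [Finset.union_sdiff_distrib, Finset.sdiff_eq_self_of_disjoint hp.1.2,
        Finset.sdiff_eq_empty_iff_subset.mpr hRS, Finset.union_empty]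
    have hinter : (Y ∪ R) ∩ S = R := by
      rw [Finset.union_inter_distrib_right, Finset.disjoint_iff_inter_eq_empty.mp hp.1.2,
        Finset.empty_union, Finset.inter_eq_left.mpr hRS]
    simp only [hsdiff, hinter]

lemma sum_powerset_pow {ι : Type} (U : Finset ι) (x : ℝ) :
    ∑ R ∈ U.powerset, x ^ R.card = (1 + x) ^ U.card := by
  simpa [add_comm] using Finset.sum_pow_mul_eq_add_pow x 1 U

open scoped Classical in
/-- A bound for the conditional expectation of `g` given the set outside `S` yields a bound for
the expectation of `F * g`, if `F` does not depend on the set inside `S`. -/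
lemma indepSum_mul_le {S : Finset V} (hS : G.IsIndepSet (S : Set V)) {lam K : ℝ} (hlam : 0 ≤ lam)
    {F g : Finset V → ℝ} (hF₀ : ∀ X, 0 ≤ F X) (hF : ∀ Y R, R ⊆ S → F (Y ∪ R) = F Y)
    (hg : ∀ Y : Finset V, Disjoint Y S →
      ∑ R ∈ (S.filter (Free G Y)).powerset, lam ^ R.card * g (Y ∪ R) ≤
        K * (1 + lam) ^ (S.filter (Free G Y)).card) :
    indepSum G (fun X => lam ^ X.card * (F X * g X)) ≤
      K * indepSum G (fun X => lam ^ X.card * F X) := by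
  have hpull : ∀ (f : Finset V → ℝ) (Y : Finset V), Disjoint Y S →
      ∑ R ∈ (S.filter (Free G Y)).powerset, lam ^ (Y ∪ R).card * (F (Y ∪ R) * f (Y ∪ R)) =
      lam ^ Y.card * F Y * ∑ R ∈ (S.filter (Free G Y)).powerset, lam ^ R.card * f (Y ∪ R) := by
    intro f Y hYS
    rw [Finset.mul_sum]
    refine Finset.sum_congr rfl fun R hR => ?_
    have hRS := (Finset.mem_powerset.mp hR).trans (Finset.filter_subset _ _)
    rw [Finset.card_union_of_disjoint (hYS.mono_right hRS), hF Y R hRS, pow_add]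
    ring
  rw [indepSum_split hS, indepSum_split hS (fun X => lam ^ X.card * F X), mul_indepSum]
  refine indepSum_mono fun Y => ?_
  split_ifs with hYS
  · have hone := hpull (fun _ => 1) Y hYS
    simp only [mul_one, sum_powerset_pow] at hone
    rw [hpull g Y hYS, hone, mul_left_comm]
    exact mul_le_mul_of_nonneg_left (hg Y hYS) (mul_nonneg (pow_nonneg hlam _) (hF₀ Y))
  · simp

open scoped Classical in
lemma indepSum_resample {lam : ℝ} (h : 0 ≤ lam) (v : V) (F : Finset V → ℝ) :
    indepSum G (fun X => lam ^ X.card * (lam / (1 + lam) *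
        F (if Free G X v then insert v X else X) + 1 / (1 + lam) * F (X.erase v))) =
      indepSum G fun X => lam ^ X.card * F X := by
  have hS : G.IsIndepSet (({v} : Finset V) : Set V) := by simp
  have h1 : 1 + lam ≠ 0 := by linarith
  rw [indepSum_split hS, indepSum_split hS fun X => lam ^ X.card * F X]
  congr 1 with Y
  split_ifs with hY
  · have hv : v ∉ Y := Finset.disjoint_singleton_right.mp hY
    by_cases hfree : Free G Y v
    · have hfree' : Free G (insert v Y) v := by simpa [Free] using hfree
      rw [Finset.filter_singleton, if_pos hfree, ← insert_empty_eq v,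
        Finset.sum_powerset_insert (Finset.notMem_empty v),
        Finset.sum_powerset_insert (Finset.notMem_empty v)]
      simp only [insert_empty_eq, Finset.powerset_empty, Finset.sum_singleton,
        Finset.union_empty, Finset.union_singleton, hfree, hfree', if_true, Finset.insert_idem,
        Finset.erase_eq_of_notMem hv, Finset.erase_insert hv, Finset.card_insert_of_notMem hv]
      field_simp
      ring
    · simp only [Finset.filter_singleton, hfree, if_false, Finset.powerset_empty,
        Finset.sum_singleton, Finset.union_empty, Finset.erase_eq_of_notMem hv]
      field_simp
      ring
  · rfl

end IndepSum

section PartitionFunction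

variable {V : Type} [Fintype V] {G : SimpleGraph V}

lemma partitionFunction_eq (lam : ℝ) :
    partitionFunction G lam = indepSum G fun X => lam ^ X.card :=
  sum_val_eq_indepSum fun X => lam ^ X.card

lemma partitionFunction_pos {lam : ℝ} (h : 0 ≤ lam) : 0 < partitionFunction G lam :=
  Finset.sum_pos' (fun X _ => pow_nonneg h _)
    ⟨emptySet G, Finset.mem_univ _, by simp [emptySet]⟩

lemma sum_pow_card_sdiff_le [DecidableEq V] {h : ℝ} (hh : 0 ≤ h) (S : Finset V)
    {𝒴 : Finset (Finset V)} (h𝒴 : ∀ Y ∈ 𝒴, S ⊆ Y) :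
    ∑ Y ∈ 𝒴, h ^ (Y \ S).card ≤ (1 + h) ^ Fintype.card V := by
  rw [← Finset.card_univ, ← sum_powerset_pow,
    ← Finset.sum_image (f := fun D : Finset V => h ^ D.card) (g := (· \ S))]
  · exact Finset.sum_le_sum_of_subset_of_nonneg (by simp) fun D _ _ => pow_nonneg hh _
  · intro Y hY Y' hY' he
    rw [← Finset.sdiff_union_of_subset (h𝒴 Y hY), ← Finset.sdiff_union_of_subset (h𝒴 Y' hY')]
    exact congrArg (· ∪ S) he

/-- Expand `(lam + h) ^ |Y|` over the subsets `S` of `Y`, which are independent as well, and then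
sum over `Y` first. -/
lemma partitionFunction_add_le {lam h : ℝ} (hlam : 0 ≤ lam) (hh : 0 ≤ h) :
    partitionFunction G (lam + h) ≤ (1 + h) ^ Fintype.card V * partitionFunction G lam := by
  classical
  rw [partitionFunction_eq, partitionFunction_eq, mul_indepSum]
  unfold indepSum
  calc _ = ∑ Y ∈ Finset.univ.filter (fun X : Finset V => G.IsIndepSet (X : Set V)),
        ∑ S ∈ Y.powerset, lam ^ S.card * h ^ (Y \ S).card := by
        refine Finset.sum_congr rfl fun Y _ => ?_
        simp only [← Finset.sum_pow_mul_eq_add_pow]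
        refine Finset.sum_congr rfl fun S hS => ?_
        rw [Finset.card_sdiff_of_subset (Finset.mem_powerset.mp hS)]
    _ = ∑ S ∈ Finset.univ.filter (fun X : Finset V => G.IsIndepSet (X : Set V)),
        ∑ Y ∈ Finset.univ.filter (fun X : Finset V => G.IsIndepSet (X : Set V) ∧ S ⊆ X),
          lam ^ S.card * h ^ (Y \ S).card := by
        refine Finset.sum_comm' fun Y S => ?_
        simp only [Finset.mem_filter, Finset.mem_univ, true_and, Finset.mem_powerset]
        exact ⟨fun hYS => ⟨hYS, hYS.1.mono (by exact_mod_cast hYS.2)⟩, And.left⟩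
    _ ≤ _ := Finset.sum_le_sum fun S _ => by
        rw [← Finset.mul_sum, mul_comm]
        exact mul_le_mul_of_nonneg_right
          (sum_pow_card_sdiff_le hh S fun Y hY => (Finset.mem_filter.mp hY).2.2)
          (pow_nonneg hlam _)

lemma partitionFunction_le_three_mul {lam lam' : ℝ} (h : 0 ≤ lam) (hle : lam ≤ lam')
    (hd : (lam' - lam) * Fintype.card V ≤ 1) :
    partitionFunction G lam' ≤ 3 * partitionFunction G lam := by
  have hpow : (1 + (lam' - lam)) ^ Fintype.card V ≤ 3 :=
    calc (1 + (lam' - lam)) ^ Fintype.card V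
        ≤ Real.exp (lam' - lam) ^ Fintype.card V :=
          pow_le_pow_left₀ (by linarith) (by linarith [Real.add_one_le_exp (lam' - lam)]) _
      _ = Real.exp ((lam' - lam) * Fintype.card V) := by rw [← Real.exp_nat_mul, mul_comm]
      _ ≤ Real.exp 1 := Real.exp_le_exp.mpr hd
      _ ≤ 3 := by linarith [Real.exp_one_lt_d9]
  calc partitionFunction G lam' = partitionFunction G (lam + (lam' - lam)) := by
        rw [add_sub_cancel]
    _ ≤ _ := partitionFunction_add_le h (sub_nonneg.mpr hle)
    _ ≤ _ := mul_le_mul_of_nonneg_right hpow (partitionFunction_pos h).le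

end PartitionFunction

section Gibbs

variable {V : Type} [Fintype V] (G : SimpleGraph V)

lemma gibbs_nonneg {lam : ℝ} (h : 0 ≤ lam) (X : IndepSets G) : 0 ≤ gibbs G lam X :=
  div_nonneg (pow_nonneg h _) (partitionFunction_pos h).le

/-- The Gibbs distribution as a probability mass function. -/
noncomputable def gibbsPMF (lam : ℝ) (h : 0 ≤ lam) : PMF (IndepSets G) :=
  PMF.ofFintype (fun X => ENNReal.ofReal (gibbs G lam X)) <| by
    rw [← ENNReal.ofReal_sum_of_nonneg fun X _ => gibbs_nonneg G h X]
    simp only [gibbs]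
    rw [← Finset.sum_div, ← partitionFunction, div_self (partitionFunction_pos h).ne',
      ENNReal.ofReal_one]

variable {G}

lemma gibbsPMF_toReal {lam : ℝ} (h : 0 ≤ lam) (X : IndepSets G) :
    (gibbsPMF G lam h X).toReal = gibbs G lam X :=
  ENNReal.toReal_ofReal (gibbs_nonneg G h X)

lemma expect_gibbs {lam : ℝ} (h : 0 ≤ lam) (F : Finset V → ℝ) :
    expect (gibbsPMF G lam h) (fun X => F X.1) =
      indepSum G (fun X => lam ^ X.card * F X) / partitionFunction G lam := by
  simp only [expect, gibbsPMF_toReal, gibbs, div_mul_eq_mul_div]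
  rw [← Finset.sum_div, sum_val_eq_indepSum fun X => lam ^ X.card * F X]

open scoped Classical in
lemma expect_gibbs_mul_le [DecidableEq V] {S : Finset V} (hS : G.IsIndepSet (S : Set V)) {lam K : ℝ}
    (hlam : 0 ≤ lam) {F g : Finset V → ℝ} (hF₀ : ∀ X, 0 ≤ F X)
    (hF : ∀ Y R, R ⊆ S → F (Y ∪ R) = F Y)
    (hg : ∀ Y : Finset V, Disjoint Y S →
      ∑ R ∈ (S.filter (Free G Y)).powerset, lam ^ R.card * g (Y ∪ R) ≤
        K * (1 + lam) ^ (S.filter (Free G Y)).card) :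
    expect (gibbsPMF G lam hlam) (fun X => F X.1 * g X.1) ≤
      K * expect (gibbsPMF G lam hlam) fun X => F X.1 := by
  rw [expect_gibbs hlam (fun X => F X * g X), expect_gibbs, ← mul_div_assoc]
  exact div_le_div_of_nonneg_right (indepSum_mul_le hS hlam hF₀ hF hg)
    (partitionFunction_pos hlam).le

lemma isWarm_gibbs {lam lam' : ℝ} (h : 0 ≤ lam) (hle : lam ≤ lam')
    (hd : (lam' - lam) * Fintype.card V ≤ 1) :
    IsWarm 3 (gibbsPMF G lam h) (gibbsPMF G lam' (h.trans hle)) := fun X => by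
  have hp := partitionFunction_pos (G := G) h
  have hp' := partitionFunction_pos (G := G) (h.trans hle)
  have hreal : gibbs G lam X ≤ 3 * gibbs G lam' X := by
    rw [gibbs, gibbs, ← mul_div_assoc, div_le_div_iff₀ hp hp', mul_right_comm, mul_comm]
    gcongr
    exact partitionFunction_le_three_mul h hle hd
  calc ENNReal.ofReal (gibbs G lam X) ≤ ENNReal.ofReal (3 * gibbs G lam' X) :=
        ENNReal.ofReal_le_ofReal hreal
    _ = _ := by
        rw [ENNReal.ofReal_mul (by norm_num), ENNReal.ofReal_ofNat]
        rfl

lemma gibbsPMF_zero : gibbsPMF G 0 le_rfl = PMF.pure (emptySet G) := by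
  have hgibbs : ∀ X : IndepSets G, X ≠ emptySet G → gibbs G 0 X = 0 := fun X hX => by
    have hcard : X.1.card ≠ 0 := fun h0 => hX (Subtype.ext (Finset.card_eq_zero.mp h0))
    simp [gibbs, hcard]
  have hsum := sum_toReal (gibbsPMF G 0 le_rfl)
  simp only [gibbsPMF_toReal] at hsum
  rw [Fintype.sum_eq_single _ hgibbs] at hsum
  refine ext_of_expect fun f => ?_
  rw [expect_pure, expect]
  simp only [gibbsPMF_toReal]
  rw [Fintype.sum_eq_single (emptySet G) fun X hX => by rw [hgibbs X hX, zero_mul], hsum,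
    one_mul]

end Gibbs

section Glauber

variable {V : Type} [Fintype V] [Nonempty V]

variable (V) in
/-- The randomness of one step of the Glauber dynamics: a vertex and the result of a coin. -/
noncomputable def randomUpdate (lam : ℝ) : PMF (V × Bool) :=
  (PMF.uniformOfFintype V).bind fun v => (coin (lam / (1 + lam))).map (Prod.mk v)

lemma expect_randomUpdate {lam : ℝ} (h : 0 ≤ lam) (f : V × Bool → ℝ) :
    expect (randomUpdate V lam) f = (1 / (Fintype.card V : ℝ)) *
      ∑ v, (lam / (1 + lam) * f (v, true) + 1 / (1 + lam) * f (v, false)) := by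
  have h1 : 0 < 1 + lam := by linarith
  have hcompl : 1 - lam / (1 + lam) = 1 / (1 + lam) := by field_simp; ring
  have hle : lam / (1 + lam) ≤ 1 := (div_le_one h1).mpr (by linarith)
  simp only [randomUpdate, expect_bind, expect_uniform, expect_map,
    expect_coin (div_nonneg h h1.le) hle, hcompl]

variable [DecidableEq V] {G : SimpleGraph V}

lemma glauberStep_eq_map (lam : ℝ) (X : IndepSets G) :
    glauberStep G lam X = (randomUpdate V lam).map fun p => update G X p.1 p.2 := by
  simp only [glauberStep, randomUpdate, PMF.map_bind, PMF.map_comp, Function.comp_def]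

lemma gibbsPMF_bind_glauberStep {lam : ℝ} (h : 0 ≤ lam) :
    (gibbsPMF G lam h).bind (glauberStep G lam) = gibbsPMF G lam h := by
  classical
  refine ext_of_expect fun f => ?_
  obtain ⟨F, rfl⟩ : ∃ F : Finset V → ℝ, f = fun X => F X.1 :=
    (Subtype.val_injective.surjective_comp_right f).imp fun _ => Eq.symm
  have hn : (Fintype.card V : ℝ) ≠ 0 := by exact_mod_cast Fintype.card_ne_zero
  simp only [expect_bind, glauberStep_eq_map, expect_map, expect_randomUpdate h,
    update_true_val, update_false_val]
  rw [expect_mul_left, expect_sum]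
  have hv : ∀ v, expect (gibbsPMF G lam h) (fun X => lam / (1 + lam) *
      F (if Free G X.1 v then insert v X.1 else X.1) + 1 / (1 + lam) * F (X.1.erase v)) =
      expect (gibbsPMF G lam h) fun X => F X.1 := fun v => by
    rw [expect_gibbs h fun X => lam / (1 + lam) *
      F (if Free G X v then insert v X else X) + 1 / (1 + lam) * F (X.erase v),
      indepSum_resample h v F, expect_gibbs]
  rw [Finset.sum_congr rfl fun v _ => hv v, Finset.sum_const, Finset.card_univ, nsmul_eq_mul]
  field_simp

end Glauber

section Girth

variable {V : Type} {G : SimpleGraph V}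

lemma no_triangle (hg : 4 ≤ G.egirth) {a b c : V} (hab : G.Adj a b) (hbc : G.Adj b c)
    (hca : G.Adj c a) : False := by
  have h := SimpleGraph.le_egirth.mp hg a (.cons hab (.cons hbc (.cons hca .nil))) (by
    simp [SimpleGraph.Walk.cons_isCycle_iff, hab.ne, hbc.ne, hca.ne, hab.ne', hca.ne'])
  norm_num at h

lemma no_quadrangle (hg : 5 ≤ G.egirth) {a b c d : V} (hab : G.Adj a b) (hbc : G.Adj b c)
    (hcd : G.Adj c d) (hda : G.Adj d a) (hac : a ≠ c) (hbd : b ≠ d) : False := by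
  have h := SimpleGraph.le_egirth.mp hg a (.cons hab (.cons hbc (.cons hcd (.cons hda .nil)))) (by
    simp [SimpleGraph.Walk.cons_isCycle_iff, hab.ne, hbc.ne, hcd.ne, hda.ne, hab.ne', hda.ne',
      hbd, hac, hac.symm])
  norm_num at h

lemma no_pentagon (hg : 6 ≤ G.egirth) {a b c d e : V} (hab : G.Adj a b) (hbc : G.Adj b c)
    (hcd : G.Adj c d) (hde : G.Adj d e) (hea : G.Adj e a) : False := by
  have hg4 : 4 ≤ G.egirth := le_trans (by norm_num) hg
  have hac : a ≠ c := by rintro rfl; exact no_triangle hg4 hcd hde hea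
  have hbd : b ≠ d := by rintro rfl; exact no_triangle hg4 hde hea hab
  have hce : c ≠ e := by rintro rfl; exact no_triangle hg4 hea hab hbc
  have hda : d ≠ a := by rintro rfl; exact no_triangle hg4 hab hbc hcd
  have heb : e ≠ b := by rintro rfl; exact no_triangle hg4 hbc hcd hde
  have h := SimpleGraph.le_egirth.mp hg a
    (.cons hab (.cons hbc (.cons hcd (.cons hde (.cons hea .nil))))) (by
    simp [SimpleGraph.Walk.cons_isCycle_iff, hab.ne, hbc.ne, hcd.ne, hde.ne, hea.ne, hab.ne',
      hea.ne', hbd, hce, hda, hac, hac.symm, heb.symm])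
  norm_num at h

lemma isIndepSet_neighborFinset (hg : 4 ≤ G.egirth) (v : V)
    [Fintype (G.neighborSet v)] :
    G.IsIndepSet (G.neighborFinset v : Set V) := by
  intro x hx y hy _ hadj
  simp only [SimpleGraph.coe_neighborFinset, SimpleGraph.mem_neighborSet] at hx hy
  exact no_triangle hg hx hadj hy.symm

end Girth

section Children

variable {V : Type} [Fintype V] [DecidableEq V] (G : SimpleGraph V) [DecidableRel G.Adj]

/-- The neighbours of `w` other than `v`: the children of `w` if the tree-like neighbourhood of
its neighbour `v` is rooted at `v`. -/
def children (v w : V) : Finset V := (G.neighborFinset w).erase v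

/-- The number of neighbours of `v` that are not blocked by a vertex other than `v`. -/
def unblocked (X : Finset V) (v : V) : ℕ :=
  ((G.neighborFinset v).filter fun w => Disjoint X (children G v w)).card

/-- Indicator of the event that no child of `w` is occupied. -/
def childless (v w : V) (X : Finset V) : ℝ := if Disjoint X (children G v w) then 1 else 0

open scoped Classical in
/-- The number of children of `w` that are not blocked. -/
noncomputable def freeChildren (v w : V) (X : Finset V) : ℕ :=
  ((children G v w).filter (Free G X)).card

/-- The conditional probability, under the Gibbs distribution, that no child of `w` is occupied,
given the configuration outside the children of `w`. -/
noncomputable def childlessProb (lam : ℝ) (v w : V) (X : Finset V) : ℝ :=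
  ((1 + lam) ^ freeChildren G v w X)⁻¹

/-- The deviation of `childless` from its conditional expectation. -/
noncomputable def childlessDev (lam : ℝ) (v w : V) (X : Finset V) : ℝ :=
  childless G v w X - childlessProb G lam v w X

variable {G}

lemma mem_children {v w x : V} : x ∈ children G v w ↔ x ≠ v ∧ G.Adj w x := by
  simp [children]

lemma sum_childless (X : Finset V) (v : V) :
    ∑ w ∈ G.neighborFinset v, childless G v w X = unblocked G X v := by
  simp only [childless, unblocked, Finset.sum_boole]

lemma childlessProb_nonneg {lam : ℝ} (h : 0 ≤ lam) (v w : V) (X : Finset V) :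
    0 ≤ childlessProb G lam v w X := by unfold childlessProb; positivity

lemma childlessProb_le_one {lam : ℝ} (h : 0 ≤ lam) (v w : V) (X : Finset V) :
    childlessProb G lam v w X ≤ 1 :=
  inv_le_one_of_one_le₀ (one_le_pow₀ (by linarith))

lemma childlessProb_union {lam : ℝ} {v w : V} {Y R : Finset V}
    (h : ∀ x ∈ children G v w, ∀ u ∈ R, ¬ G.Adj x u) :
    childlessProb G lam v w (Y ∪ R) = childlessProb G lam v w Y := by
  classical
  have hfilter : (children G v w).filter (Free G (Y ∪ R)) = (children G v w).filter (Free G Y) :=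
    Finset.filter_congr fun x hx => free_union_iff (h x hx)
  simp only [childlessProb, freeChildren, hfilter]

lemma isIndepSet_children (hg : 4 ≤ G.egirth) (v w : V) :
    G.IsIndepSet (children G v w : Set V) :=
  (isIndepSet_neighborFinset hg w).mono (Finset.coe_subset.mpr (Finset.erase_subset _ _))

lemma childlessProb_union_children (hg : 4 ≤ G.egirth) {lam : ℝ} {v w : V} {Y R : Finset V}
    (hR : R ⊆ children G v w) : childlessProb G lam v w (Y ∪ R) = childlessProb G lam v w Y :=
  childlessProb_union fun _ hx _ hu hadj => isIndepSet_children hg v w hx (hR hu) hadj.ne hadj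

lemma childless_union_children {v w : V} {Y R : Finset V} (hY : Disjoint Y (children G v w))
    (hR : R ⊆ children G v w) : childless G v w (Y ∪ R) = if R = ∅ then 1 else 0 := by
  have hdisj : Disjoint (Y ∪ R) (children G v w) ↔ R = ∅ := by
    rw [Finset.disjoint_union_left, and_iff_right hY]
    exact ⟨fun h => (Finset.disjoint_self_iff_empty R).mp (h.mono_right hR),
      fun h => h ▸ Finset.disjoint_empty_left _⟩
  simp only [childless, hdisj]

/-- Since there are no quadrangles and no pentagons, distinct neighbours of `v` have disjoint sets
of children, and these are not joined by edges. -/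
lemma childlessDev_union_children (hg : 6 ≤ G.egirth) {lam : ℝ} {v w w' : V} (hw : G.Adj v w)
    (hw' : G.Adj v w') (hne : w ≠ w') {Y R : Finset V} (hR : R ⊆ children G v w) :
    childlessDev G lam v w' (Y ∪ R) = childlessDev G lam v w' Y := by
  have hdisj : Disjoint R (children G v w') := Finset.disjoint_left.mpr fun x hxR hx => by
    obtain ⟨hxv, hwx⟩ := mem_children.mp (hR hxR)
    exact no_quadrangle (le_trans (by norm_num) hg) hw hwx (mem_children.mp hx).2.symm hw'.symm
      hxv.symm hne
  have hnadj : ∀ x ∈ children G v w', ∀ u ∈ R, ¬ G.Adj x u := fun x hx u hu hadj =>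
    no_pentagon hg hw (mem_children.mp (hR hu)).2 hadj.symm (mem_children.mp hx).2.symm hw'.symm
  simp only [childlessDev, childless, Finset.disjoint_union_left, hdisj, and_true,
    childlessProb_union hnadj]

end Children

section Concentration

variable {V : Type} [Fintype V] [DecidableEq V] {G : SimpleGraph V} [DecidableRel G.Adj]

lemma bernoulli_mgf_le {p θ : ℝ} (h0 : 0 ≤ p) (h1 : p ≤ 1) (hθ : |θ| ≤ 1) :
    p * Real.exp (θ * (1 - p)) + (1 - p) * Real.exp (θ * (0 - p)) ≤ Real.exp (θ ^ 2) := by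
  have hquad : ∀ x : ℝ, |x| ≤ 1 → Real.exp x ≤ 1 + x + x ^ 2 := fun x hx => by
    linarith [(abs_le.mp (Real.abs_exp_sub_one_sub_id_le hx)).2]
  have hbound : ∀ x : ℝ, |x| ≤ 1 → |θ * x| ≤ 1 := fun x hx => by
    rw [abs_mul]
    exact mul_le_one₀ hθ (abs_nonneg x) hx
  have hvar : θ ^ 2 * (p * (1 - p)) ≤ θ ^ 2 :=
    mul_le_of_le_one_right (sq_nonneg θ) (by nlinarith)
  calc p * Real.exp (θ * (1 - p)) + (1 - p) * Real.exp (θ * (0 - p))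
      ≤ p * (1 + θ * (1 - p) + (θ * (1 - p)) ^ 2) +
          (1 - p) * (1 + θ * (0 - p) + (θ * (0 - p)) ^ 2) := by
        gcongr
        · exact hquad _ (hbound _ (abs_le.mpr ⟨by linarith, by linarith⟩))
        · exact hquad _ (hbound _ (abs_le.mpr ⟨by linarith, by linarith⟩))
    _ = 1 + θ ^ 2 * (p * (1 - p)) := by ring
    _ ≤ Real.exp (θ ^ 2) := by linarith [Real.add_one_le_exp (θ ^ 2)]

open scoped Classical in
lemma sum_exp_childlessDev_le (hg : 4 ≤ G.egirth) {lam θ : ℝ} (hlam : 0 ≤ lam) (hθ : |θ| ≤ 1)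
    {v w : V} {Y : Finset V} (hY : Disjoint Y (children G v w)) :
    ∑ R ∈ ((children G v w).filter (Free G Y)).powerset,
        lam ^ R.card * Real.exp (θ * childlessDev G lam v w (Y ∪ R)) ≤
      Real.exp (θ ^ 2) * (1 + lam) ^ ((children G v w).filter (Free G Y)).card := by
  set U := (children G v w).filter (Free G Y)
  set p := childlessProb G lam v w Y with hp
  have hP : (0 : ℝ) < (1 + lam) ^ U.card := by positivity
  have hpP : p * (1 + lam) ^ U.card = 1 := inv_mul_cancel₀ hP.ne'
  have hterm : ∀ R ∈ U.powerset, lam ^ R.card * Real.exp (θ * childlessDev G lam v w (Y ∪ R)) =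
      lam ^ R.card * Real.exp (θ * (0 - p)) +
        if R = ∅ then Real.exp (θ * (1 - p)) - Real.exp (θ * (0 - p)) else 0 := fun R hR => by
    have hRS : R ⊆ children G v w :=
      (Finset.mem_powerset.mp hR).trans (Finset.filter_subset _ _)
    rw [childlessDev, childlessProb_union_children hg hRS, childless_union_children hY hRS, ← hp]
    split_ifs with hR₀ <;> simp [*]
  calc _ = (1 + lam) ^ U.card * Real.exp (θ * (0 - p)) +
        (Real.exp (θ * (1 - p)) - Real.exp (θ * (0 - p))) := by
        rw [Finset.sum_congr rfl hterm, Finset.sum_add_distrib, ← Finset.sum_mul,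
          sum_powerset_pow, Finset.sum_ite_eq', if_pos (Finset.empty_mem_powerset _)]
    _ = (p * Real.exp (θ * (1 - p)) + (1 - p) * Real.exp (θ * (0 - p))) * (1 + lam) ^ U.card := by
        linear_combination (Real.exp (θ * (0 - p)) - Real.exp (θ * (1 - p))) * hpP
    _ ≤ _ := mul_le_mul_of_nonneg_right (bernoulli_mgf_le (childlessProb_nonneg hlam v w Y)
        (childlessProb_le_one hlam v w Y) hθ) hP.le

lemma expect_exp_sum_childlessDev_le (hg : 6 ≤ G.egirth) {lam θ : ℝ} (hlam : 0 ≤ lam)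
    (hθ : |θ| ≤ 1) {v : V} {W : Finset V} (hW : W ⊆ G.neighborFinset v) :
    expect (gibbsPMF G lam hlam)
        (fun X => Real.exp (θ * ∑ w ∈ W, childlessDev G lam v w X.1)) ≤
      Real.exp (θ ^ 2) ^ W.card := by
  induction W using Finset.induction_on with
  | empty => simp [expect_const]
  | insert w W hw ih =>
    have hg4 : 4 ≤ G.egirth := le_trans (by norm_num) hg
    have hvw : G.Adj v w := by simpa using hW (Finset.mem_insert_self w W)
    have hWv := (Finset.subset_insert w W).trans hW
    have hstep := expect_gibbs_mul_le (isIndepSet_children hg4 v w) hlam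
      (F := fun X => Real.exp (θ * ∑ w ∈ W, childlessDev G lam v w X))
      (g := fun X => Real.exp (θ * childlessDev G lam v w X)) (fun X => (Real.exp_pos _).le)
      (fun Y R hR => by
        have hdev : ∀ w' ∈ W, childlessDev G lam v w' (Y ∪ R) = childlessDev G lam v w' Y :=
          fun w' hw' => childlessDev_union_children hg hvw (by simpa using hWv hw')
            (ne_of_mem_of_not_mem hw' hw).symm hR
        simp only [Finset.sum_congr rfl hdev])
      (fun Y hY => sum_exp_childlessDev_le hg4 hlam hθ hY)
    calc _ = expect (gibbsPMF G lam hlam) (fun X =>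
          Real.exp (θ * ∑ w ∈ W, childlessDev G lam v w X.1) *
            Real.exp (θ * childlessDev G lam v w X.1)) := by
          simp only [Finset.sum_insert hw, ← Real.exp_add, ← mul_add, add_comm]
      _ ≤ _ := hstep
      _ ≤ Real.exp (θ ^ 2) * Real.exp (θ ^ 2) ^ W.card := by gcongr; exact ih hWv
      _ = _ := by rw [Finset.card_insert_of_notMem hw, pow_succ' (Real.exp _)]

lemma expect_exp_card_inter_le (hg : 4 ≤ G.egirth) {lam : ℝ} (hlam : 0 ≤ lam) (v : V) :
    expect (gibbsPMF G lam hlam) (fun X => Real.exp (G.neighborFinset v ∩ X.1).card) ≤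
      Real.exp (2 * (lam * G.degree v)) := by
  classical
  have hbase : 1 + lam * Real.exp 1 ≤ Real.exp (2 * lam) * (1 + lam) := by
    nlinarith [Real.add_one_le_exp (2 * lam), Real.exp_one_lt_d9]
  have hstep := expect_gibbs_mul_le (isIndepSet_neighborFinset hg v)
    (K := Real.exp (2 * (lam * G.degree v))) hlam (F := fun _ => 1)
    (g := fun X => Real.exp (G.neighborFinset v ∩ X).card) (fun _ => zero_le_one)
    (fun _ _ _ => rfl) fun Y hY => ?_
  · simpa only [one_mul, expect_const, mul_one] using hstep
  set U := (G.neighborFinset v).filter (Free G Y)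
  have hcard : (U.card : ℝ) ≤ G.degree v := by
    rw [← SimpleGraph.card_neighborFinset_eq_degree]
    exact_mod_cast Finset.card_filter_le _ _
  have hterm : ∀ R ∈ U.powerset, lam ^ R.card * Real.exp (G.neighborFinset v ∩ (Y ∪ R)).card =
      (lam * Real.exp 1) ^ R.card := fun R hR => by
    have hRS : R ⊆ G.neighborFinset v :=
      (Finset.mem_powerset.mp hR).trans (Finset.filter_subset _ _)
    rw [Finset.inter_union_distrib_left, Finset.disjoint_iff_inter_eq_empty.mp hY.symm,
      Finset.empty_union, Finset.inter_eq_right.mpr hRS, mul_pow, ← Real.exp_nat_mul, mul_one]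
  calc _ = (1 + lam * Real.exp 1) ^ U.card := by
        rw [Finset.sum_congr rfl hterm, sum_powerset_pow]
    _ ≤ (Real.exp (2 * lam) * (1 + lam)) ^ U.card := by gcongr
    _ = Real.exp (2 * (lam * U.card)) * (1 + lam) ^ U.card := by
        rw [mul_pow, ← Real.exp_nat_mul]
        ring_nf
    _ ≤ _ := by gcongr

variable (G) in
/-- The local statistics of `X` at `v` are typical: the number of unblocked neighbours is close to
the sum of the conditional probabilities, and few neighbours are occupied. -/
def TypicalAt (lam η : ℝ) (X : Finset V) (v : V) : Prop :=
  |∑ w ∈ G.neighborFinset v, childlessDev G lam v w X| ≤ η * G.degree v ∧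
    ((G.neighborFinset v ∩ X).card : ℝ) ≤ η * G.degree v

lemma prob_not_typicalAt_le (hg : 6 ≤ G.egirth) {lam η : ℝ} (hlam : 0 ≤ lam) (hη : 0 < η)
    (hη1 : η ≤ 1) (v : V) (hv : lam * G.degree v ≤ 3) :
    prob (gibbsPMF G lam hlam) {X | ¬ TypicalAt G lam η X.1 v} ≤
      (2 + Real.exp 6) * Real.exp (-(η ^ 2 / 4 * G.degree v)) := by
  set S : IndepSets G → ℝ := fun X => ∑ w ∈ G.neighborFinset v, childlessDev G lam v w X.1
  set N : IndepSets G → ℝ := fun X => (G.neighborFinset v ∩ X.1).card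
  set d := (G.degree v : ℝ) with hd
  have hdev : ∀ θ : ℝ, |θ| = η / 2 →
      prob (gibbsPMF G lam hlam) {X | η ^ 2 / 2 * d < θ * S X} ≤
        Real.exp (-(η ^ 2 / 4 * d)) := fun θ hθ => by
    have hmgf := expect_exp_sum_childlessDev_le hg hlam (by rw [hθ]; linarith : |θ| ≤ 1)
      (Finset.Subset.refl (G.neighborFinset v))
    calc _ ≤ Real.exp (-(η ^ 2 / 2 * d)) * Real.exp (θ ^ 2) ^ (G.neighborFinset v).card :=
          (prob_lt_le _ _ _).trans (by gcongr)
      _ = _ := by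
          rw [SimpleGraph.card_neighborFinset_eq_degree, ← Real.exp_nat_mul, ← Real.exp_add,
            ← sq_abs θ, hθ, ← hd]
          ring_nf
  have hocc : prob (gibbsPMF G lam hlam) {X | η * d < N X} ≤
      Real.exp 6 * Real.exp (-(η ^ 2 / 4 * d)) :=
    calc _ ≤ Real.exp (-(η * d)) * Real.exp (2 * (lam * d)) :=
          (prob_lt_le _ _ _).trans <| mul_le_mul_of_nonneg_left
            (expect_exp_card_inter_le (le_trans (by norm_num) hg) hlam v) (Real.exp_pos _).le
      _ ≤ Real.exp (-(η ^ 2 / 4 * d)) * Real.exp 6 := by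
          gcongr
          · nlinarith
          · linarith
      _ = _ := mul_comm _ _
  have hsub : {X : IndepSets G | ¬ TypicalAt G lam η X.1 v} ⊆
      ({X | η ^ 2 / 2 * d < η / 2 * S X} ∪ {X | η ^ 2 / 2 * d < -(η / 2) * S X}) ∪
        {X | η * d < N X} := fun X hX => by
    simp only [Set.mem_union, Set.mem_ofPred_eq] at hX ⊢
    contrapose! hX
    obtain ⟨⟨hpos, hneg⟩, hN⟩ := hX
    exact ⟨abs_le.mpr ⟨by nlinarith, by nlinarith⟩, hN⟩
  have hdevPos := hdev (η / 2) (abs_of_pos (by linarith))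
  have hdevNeg := hdev (-(η / 2)) (by rw [abs_neg, abs_of_pos (by linarith)])
  linarith [prob_mono (gibbsPMF G lam hlam) hsub, prob_union_le (gibbsPMF G lam hlam)
    ({X | η ^ 2 / 2 * d < η / 2 * S X} ∪ {X | η ^ 2 / 2 * d < -(η / 2) * S X}) {X | η * d < N X},
    prob_union_le (gibbsPMF G lam hlam) {X | η ^ 2 / 2 * d < η / 2 * S X}
      {X | η ^ 2 / 2 * d < -(η / 2) * S X}]

lemma prob_exists_not_typicalAt_le (hg : 6 ≤ G.egirth) {lam η : ℝ} {Δ : ℕ} (hlam : 0 ≤ lam)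
    (hΔ : lam * Δ ≤ 3) (hη : 0 < η) (hη1 : η ≤ 1) (hreg : G.IsRegularOfDegree Δ) :
    prob (gibbsPMF G lam hlam) {X | ∃ v, ¬ TypicalAt G lam η X.1 v} ≤
      Fintype.card V * ((2 + Real.exp 6) * Real.exp (-(η ^ 2 / 4 * Δ))) :=
  calc _ = prob (gibbsPMF G lam hlam) (⋃ v, {X | ¬ TypicalAt G lam η X.1 v}) := by
        rw [Set.ofPred_exists]
    _ ≤ ∑ v, prob (gibbsPMF G lam hlam) {X | ¬ TypicalAt G lam η X.1 v} := prob_iUnion_le _ _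
    _ ≤ ∑ _v : V, (2 + Real.exp 6) * Real.exp (-(η ^ 2 / 4 * Δ)) := by
        refine Finset.sum_le_sum fun v _ => ?_
        simpa only [hreg v] using
          prob_not_typicalAt_le hg hlam hη hη1 v (by rwa [hreg v] : lam * G.degree v ≤ 3)
    _ = _ := by rw [Finset.sum_const, Finset.card_univ, nsmul_eq_mul]

end Concentration

section FixedPoint

open Real

lemma mul_exp_neg_lt {z s : ℝ} (hs0 : 0 < s) (hs1 : s ≤ 1) (hz : z < s) :
    z * exp (-z) < s * exp (-s) := by
  have hexp := add_one_lt_exp (sub_ne_zero.mpr hz.ne : z - s ≠ 0)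
  have hz' : z < s * exp (z - s) := by nlinarith
  calc z * exp (-z) < s * exp (z - s) * exp (-z) := mul_lt_mul_of_pos_right hz' (exp_pos _)
    _ = s * exp (-s) := by rw [mul_assoc, ← exp_add]; ring_nf

lemma one_sub_exp_le_log {y : ℝ} (hy : 1 ≤ y) : 1 - exp (1 - y) ≤ log y := by
  have hderiv : ∀ x : ℝ, 1 ≤ x →
      HasDerivAt (fun x => log x + exp (1 - x)) (x⁻¹ + exp (1 - x) * -1) x := fun x hx =>
    (hasDerivAt_log (by linarith)).add ((hasDerivAt_id x).const_sub 1).exp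
  have hmono : MonotoneOn (fun x => log x + exp (1 - x)) (Set.Ici 1) := by
    refine monotoneOn_of_hasDerivWithinAt_nonneg (convex_Ici 1)
      (fun x hx => (hderiv x hx).continuousAt.continuousWithinAt)
      (fun x hx => (hderiv x (interior_subset hx)).hasDerivWithinAt) fun x hx => ?_
    have hx1 : 1 ≤ x := interior_subset hx
    have hexp : x ≤ exp (x - 1) := by linarith [add_one_le_exp (x - 1)]
    have hinv := inv_anti₀ (by linarith) hexp
    rw [← exp_neg, neg_sub] at hinv
    linarith
  have h := hmono Set.self_mem_Ici hy hy
  simp only [log_one, sub_self, exp_zero] at h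
  linarith

/-- Below the threshold `e`, the two-fold iteration of `x ↦ c * exp (-x)` stays below the
diagonal to the right of `1 - ε / 4`; with `z = c * exp (-y)` this says that
`z * exp (-z) < y * exp (-y)`. -/
lemma two_step_lt {ε c y : ℝ} (h0 : 0 < ε) (h1 : ε < 1) (hc : c ≤ (1 - ε) * exp 1)
    (hy : 1 - ε / 4 ≤ y) : c * exp (-(c * exp (-y))) < y := by
  set z := c * exp (-y) with hz
  have hcz : c = z * exp y := by rw [hz, mul_assoc, ← exp_add]; simp
  have hzle : z ≤ (1 - ε) * exp (1 - y) := by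
    rw [hz, sub_eq_add_neg 1 y, exp_add, ← mul_assoc]
    exact mul_le_mul_of_nonneg_right hc (exp_pos _).le
  have hexp := exp_pos (1 - y)
  have hmain : z * exp (-z) < y * exp (-y) := by
    rcases lt_or_ge y 1 with hy1 | hy1
    · refine mul_exp_neg_lt (by linarith) hy1.le (hzle.trans_lt ?_)
      have hyexp : y * exp (1 - y) ≤ 1 := by
        have hinv : exp (1 - y) * exp (y - 1) = 1 := by rw [← exp_add]; simp
        nlinarith [add_one_le_exp (y - 1)]
      nlinarith
    · have hzlt : z < exp (1 - y) := hzle.trans_lt (by nlinarith)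
      calc z * exp (-z) < exp (1 - y) * exp (-exp (1 - y)) :=
            mul_exp_neg_lt hexp (exp_le_one_iff.mpr (by linarith)) hzlt
        _ = exp (1 - exp (1 - y)) * exp (-y) := by rw [← exp_add, ← exp_add]; ring_nf
        _ ≤ exp (log y) * exp (-y) := by gcongr; exact one_sub_exp_le_log hy1
        _ = y * exp (-y) := by rw [exp_log (by linarith)]
  calc c * exp (-z) = z * exp (-z) * exp y := by rw [hcz]; ring
    _ < y * exp (-y) * exp y := mul_lt_mul_of_pos_right hmain (exp_pos y)
    _ = y := by rw [mul_assoc, ← exp_add]; simp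

/-- The two-fold iteration of `x ↦ c * exp (-x)` stays below the diagonal by at least `κ` on
`[1 - ε / 4, 3]`, uniformly in the parameters `c` of the regime `c ≤ (1 - ε) * e`. -/
def TwoStepGap (ε κ : ℝ) : Prop :=
  ∀ c y : ℝ, 0 ≤ c → c ≤ (1 - ε) * exp 1 → 1 - ε / 4 ≤ y → y ≤ 3 →
    c * exp (-(c * exp (-y))) + κ ≤ y

lemma exists_twoStepGap {ε : ℝ} (h0 : 0 < ε) (h1 : ε < 1) : ∃ κ > 0, TwoStepGap ε κ := by
  have hK : IsCompact (Set.Icc (0 : ℝ) ((1 - ε) * exp 1) ×ˢ Set.Icc (1 - ε / 4) 3) :=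
    isCompact_Icc.prod isCompact_Icc
  have hne : (Set.Icc (0 : ℝ) ((1 - ε) * exp 1) ×ˢ Set.Icc (1 - ε / 4) 3).Nonempty :=
    (Set.nonempty_Icc.mpr (mul_nonneg (by linarith) (exp_pos 1).le)).prod
      (Set.nonempty_Icc.mpr (by linarith))
  obtain ⟨⟨c₀, y₀⟩, hmem, hmin⟩ := hK.exists_isMinOn hne
    (f := fun p : ℝ × ℝ => p.2 - p.1 * exp (-(p.1 * exp (-p.2)))) (by fun_prop)
  refine ⟨y₀ - c₀ * exp (-(c₀ * exp (-y₀))),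
    sub_pos.mpr (two_step_lt h0 h1 hmem.1.2 hmem.2.1), fun c y hc0 hc hy hy3 => ?_⟩
  have h : y₀ - c₀ * exp (-(c₀ * exp (-y₀))) ≤ y - c * exp (-(c * exp (-y))) :=
    hmin (show (c, y) ∈ _ from ⟨⟨hc0, hc⟩, hy, hy3⟩)
  linarith

/-- `x` and `y` stand for `lam` times the minimal and the maximal number of unblocked neighbours. -/
lemma le_two_step_add {c η lam x y : ℝ} (hc0 : 0 ≤ c) (hc3 : c ≤ 3) (hη : 0 ≤ η)
    (hη7 : 7 * η ≤ 1) (hlam : lam ≤ η) (hx : c * exp (-y) - c * η ≤ x)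
    (hy : y ≤ 2 * η * c + c * exp (4 * lam - x)) :
    y ≤ c * exp (-(c * exp (-y))) + 48 * η := by
  have hη14 : exp (7 * η) ≤ 1 + 14 * η := by
    have h := (abs_le.mp (abs_exp_sub_one_sub_id_le
      (by rwa [abs_of_nonneg (by linarith)] : |7 * η| ≤ 1))).2
    nlinarith
  have hexp : exp (4 * lam - x) ≤ exp (-(c * exp (-y))) * (1 + 14 * η) :=
    calc exp (4 * lam - x) ≤ exp (-(c * exp (-y)) + 7 * η) := exp_le_exp.mpr (by nlinarith)
      _ = exp (-(c * exp (-y))) * exp (7 * η) := exp_add _ _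
      _ ≤ _ := by gcongr
  have hle3 : c * exp (-(c * exp (-y))) ≤ 3 :=
    (mul_le_of_le_one_right hc0 (exp_le_one_iff.mpr
      (neg_nonpos.mpr (mul_nonneg hc0 (exp_pos _).le)))).trans hc3
  nlinarith [mul_le_mul_of_nonneg_left hexp hc0]

end FixedPoint

section LocalUniformity

variable {V : Type} [Fintype V] [DecidableEq V] {G : SimpleGraph V} [DecidableRel G.Adj]

lemma freeChildren_le_unblocked (X : Finset V) (v w : V) :
    freeChildren G v w X ≤ unblocked G X w := by
  classical
  refine Finset.card_le_card fun x hx => ?_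
  obtain ⟨hxw, hfree⟩ := Finset.mem_filter.mp hx
  exact Finset.mem_filter.mpr ⟨Finset.mem_of_mem_erase hxw,
    Finset.disjoint_left.mpr fun u hu hu' => hfree u hu (mem_children.mp hu').2⟩

lemma unblocked_le_freeChildren_add_one (v : V) {w : V} {X : Finset V} (hw : w ∉ X) :
    unblocked G X w ≤ freeChildren G v w X + 1 := by
  classical
  refine (Finset.card_le_card (t := insert v ((children G v w).filter (Free G X))) ?_).trans
    (Finset.card_insert_le _ _)
  intro x hx
  obtain ⟨hwx, hdisj⟩ := Finset.mem_filter.mp hx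
  refine Finset.mem_insert.mpr ((eq_or_ne x v).imp_right fun hxv => Finset.mem_filter.mpr
    ⟨Finset.mem_erase.mpr ⟨hxv, hwx⟩, fun u hu hadj => Finset.disjoint_left.mp hdisj hu
      (mem_children.mpr ⟨ne_of_mem_of_not_mem hu hw, hadj⟩)⟩)

lemma unblocked_le_degree (X : Finset V) (v : V) : unblocked G X v ≤ G.degree v :=
  (Finset.card_filter_le _ _).trans_eq (SimpleGraph.card_neighborFinset_eq_degree G v)

lemma exp_neg_le_childlessProb {lam M : ℝ} (hlam : 0 ≤ lam) {v w : V} {X : Finset V}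
    (hM : freeChildren G v w X ≤ M) :
    Real.exp (-(lam * M)) ≤ childlessProb G lam v w X := by
  rw [childlessProb, Real.exp_neg]
  refine inv_anti₀ (by positivity) ?_
  calc (1 + lam) ^ freeChildren G v w X ≤ Real.exp lam ^ freeChildren G v w X :=
        pow_le_pow_left₀ (by linarith) (by linarith [Real.add_one_le_exp lam]) _
    _ = Real.exp (lam * freeChildren G v w X) := by rw [← Real.exp_nat_mul, mul_comm]
    _ ≤ Real.exp (lam * M) := by gcongr

lemma exp_sub_sq_le_one_add {x : ℝ} (hx : 0 ≤ x) : Real.exp (x - x ^ 2) ≤ 1 + x := by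
  rw [← Real.le_log_iff_exp_le (by linarith)]
  have hinv : x - x ^ 2 ≤ 1 - (1 + x)⁻¹ := by
    rw [show 1 - (1 + x)⁻¹ = x / (1 + x) by field_simp; ring, le_div_iff₀ (by linarith)]
    nlinarith [pow_nonneg hx 3]
  exact hinv.trans (Real.one_sub_inv_le_log_of_pos (by linarith))

lemma childlessProb_le_exp {lam m : ℝ} (hlam : 0 ≤ lam) (hlam1 : lam ≤ 1) (hm3 : lam * m ≤ 3)
    {v w : V} {X : Finset V} (hm : m ≤ freeChildren G v w X + 1) :
    childlessProb G lam v w X ≤ Real.exp (4 * lam - lam * m) := by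
  rw [childlessProb, ← neg_sub, Real.exp_neg]
  refine inv_anti₀ (Real.exp_pos _) ?_
  have hexponent : lam * m - 4 * lam ≤ freeChildren G v w X * (lam - lam ^ 2) := by
    have hnonneg : 0 ≤ lam - lam ^ 2 := by nlinarith
    have h := mul_le_mul_of_nonneg_right (sub_le_iff_le_add.mpr hm) hnonneg
    nlinarith
  calc Real.exp (lam * m - 4 * lam)
      ≤ Real.exp (freeChildren G v w X * (lam - lam ^ 2)) := by gcongr
    _ = Real.exp (lam - lam ^ 2) ^ freeChildren G v w X := by rw [← Real.exp_nat_mul]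
    _ ≤ _ := by gcongr; exact exp_sub_sq_le_one_add hlam

lemma TypicalAt.le_unblocked {lam η M : ℝ} (hlam : 0 ≤ lam) {X : Finset V} {v : V}
    (hX : TypicalAt G lam η X v) (hM : ∀ w, unblocked G X w ≤ M) :
    G.degree v * Real.exp (-(lam * M)) - η * G.degree v ≤ unblocked G X v := by
  have hdev := (abs_le.mp hX.1).1
  simp only [childlessDev, Finset.sum_sub_distrib, sum_childless] at hdev
  have hprob := (G.neighborFinset v).card_nsmul_le_sum (childlessProb G lam v · X)
    (Real.exp (-(lam * M))) fun w _ => exp_neg_le_childlessProb hlam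
      ((Nat.cast_le.mpr (freeChildren_le_unblocked X v w)).trans (hM w))
  rw [SimpleGraph.card_neighborFinset_eq_degree, nsmul_eq_mul] at hprob
  linarith

lemma TypicalAt.unblocked_le {lam η m : ℝ} (hlam : 0 ≤ lam) (hlam1 : lam ≤ 1)
    (hm3 : lam * m ≤ 3) {X : Finset V} {v : V} (hX : TypicalAt G lam η X v)
    (hm : ∀ w, m ≤ unblocked G X w) :
    unblocked G X v ≤ 2 * (η * G.degree v) + G.degree v * Real.exp (4 * lam - lam * m) := by
  have hdev := (abs_le.mp hX.1).2
  simp only [childlessDev, Finset.sum_sub_distrib, sum_childless] at hdev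
  have hprob : ∑ w ∈ G.neighborFinset v, childlessProb G lam v w X ≤
      ∑ w ∈ G.neighborFinset v, ((if w ∈ X then 1 else 0) + Real.exp (4 * lam - lam * m)) := by
    refine Finset.sum_le_sum fun w _ => ?_
    split_ifs with hw
    · linarith [childlessProb_le_one (G := G) hlam v w X, Real.exp_pos (4 * lam - lam * m)]
    · rw [zero_add]
      exact childlessProb_le_exp hlam hlam1 hm3
        ((hm w).trans (by exact_mod_cast unblocked_le_freeChildren_add_one v hw))
  rw [Finset.sum_add_distrib, Finset.sum_const, SimpleGraph.card_neighborFinset_eq_degree,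
    nsmul_eq_mul, Finset.sum_boole, Finset.filter_mem_eq_inter] at hprob
  linarith [hX.2]

/-- If all local statistics are typical, then the largest and the smallest number of unblocked
neighbours satisfy the fixed point equation of `x ↦ lam * Δ * exp (-x)` approximately. -/
lemma lam_mul_unblocked_le {ε κ η lam : ℝ} {Δ : ℕ} (hreg : G.IsRegularOfDegree Δ)
    (hgap : TwoStepGap ε κ) (hη7 : 7 * η ≤ 1) (hηκ : 48 * η < κ) (hlam : 0 ≤ lam)
    (hlamη : lam ≤ η) (hc : lam * Δ ≤ (1 - ε) * Real.exp 1) (hc3 : lam * Δ ≤ 3) {X : Finset V}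
    (hX : ∀ v, TypicalAt G lam η X v) (v : V) :
    lam * unblocked G X v ≤ 1 - ε / 4 := by
  have : Nonempty V := ⟨v⟩
  obtain ⟨vmax, hmax⟩ := Finite.exists_max (unblocked G X)
  obtain ⟨vmin, hmin⟩ := Finite.exists_min (unblocked G X)
  set M : ℝ := (unblocked G X vmax : ℝ)
  set m : ℝ := (unblocked G X vmin : ℝ)
  have hMle : ∀ w, lam * unblocked G X w ≤ 3 := fun w => by
    have h : (unblocked G X w : ℝ) ≤ Δ := by exact_mod_cast hreg w ▸ unblocked_le_degree X w
    exact (mul_le_mul_of_nonneg_left h hlam).trans hc3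
  have lower := mul_le_mul_of_nonneg_left ((hX vmin).le_unblocked hlam (M := M)
    fun w => Nat.cast_le.mpr (hmax w)) hlam
  have upper := mul_le_mul_of_nonneg_left ((hX vmax).unblocked_le hlam (by linarith)
    (hMle vmin) fun w => Nat.cast_le.mpr (hmin w)) hlam
  rw [hreg] at lower upper
  have htwo := le_two_step_add (c := lam * Δ) (x := lam * m) (y := lam * M) (by positivity) hc3
    (hlam.trans hlamη) hη7 hlamη (by linarith) (by linarith)
  have hmaxle : lam * M ≤ 1 - ε / 4 := by
    by_contra! hcon
    linarith [hgap (lam * Δ) (lam * M) (by positivity) hc hcon.le (hMle vmax)]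
  exact (mul_le_mul_of_nonneg_left (Nat.cast_le.mpr (hmax v)) hlam).trans hmaxle

end LocalUniformity

section IdenticalCoupling

variable {V : Type} {G : SimpleGraph V} [DecidableEq V]

/-- The number of vertices at which two independent sets differ. -/
def hamming (p : IndepSets G × IndepSets G) : ℝ := (symmDiff p.1.1 p.2.1).card

lemma hamming_nonneg (p : IndepSets G × IndepSets G) : 0 ≤ hamming p := Nat.cast_nonneg _

lemma one_le_hamming {p : IndepSets G × IndepSets G} (h : p.1 ≠ p.2) : 1 ≤ hamming p :=
  Nat.one_le_cast.mpr <| Finset.card_pos.mpr <| Finset.nonempty_iff_ne_empty.mpr fun he =>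
    h <| Subtype.ext <| symmDiff_eq_bot.mp he

open scoped Classical in
lemma hamming_update_le (X Z : IndepSets G) (v : V) (b : Bool) :
    hamming (update G X v b, update G Z v b) ≤ hamming (X, Z) -
      (if v ∈ symmDiff X.1 Z.1 then 1 else 0) +
      if b = true ∧ ¬ (Free G X.1 v ↔ Free G Z.1 v) then 1 else 0 := by
  have hsub : symmDiff (update G X v b).1 (update G Z v b).1 ⊆ (symmDiff X.1 Z.1).erase v ∪
      if b = true ∧ ¬ (Free G X.1 v ↔ Free G Z.1 v) then {v} else ∅ := by
    intro u hu
    rw [Finset.mem_symmDiff, mem_update, mem_update] at hu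
    by_cases huv : u = v
    · rw [if_pos huv, if_pos huv] at hu
      rw [if_pos (by tauto), huv]
      exact Finset.mem_union_right _ (Finset.mem_singleton_self v)
    · rw [if_neg huv, if_neg huv] at hu
      exact Finset.mem_union_left _ (Finset.mem_erase.mpr ⟨huv, Finset.mem_symmDiff.mpr hu⟩)
  have herase : (((symmDiff X.1 Z.1).erase v).card : ℝ) =
      hamming (X, Z) - if v ∈ symmDiff X.1 Z.1 then 1 else 0 := by
    split_ifs with hv
    · rw [Finset.cast_card_erase_of_mem hv, hamming]
    · rw [Finset.erase_eq_of_notMem hv, sub_zero, hamming]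
  rw [← herase]
  refine (Nat.cast_le.mpr ((Finset.card_le_card hsub).trans (Finset.card_union_le _ _))).trans ?_
  rw [Nat.cast_add]
  split_ifs <;> simp

variable [Fintype V]

lemma hamming_le_card (p : IndepSets G × IndepSets G) : hamming p ≤ Fintype.card V :=
  Nat.cast_le.mpr (Finset.card_le_univ _)

open scoped Classical in
/-- The vertices that can be inserted into exactly one of two independent sets. -/
noncomputable def mismatch (p : IndepSets G × IndepSets G) : Finset V :=
  Finset.univ.filter fun v => ¬ (Free G p.1.1 v ↔ Free G p.2.1 v)

lemma exists_unblocked_of_free [DecidableRel G.Adj] {X Z : Finset V} {w : V} (hX : Free G X w)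
    (hZ : ¬ Free G Z w) :
    ∃ v ∈ Z \ X, w ∈ (G.neighborFinset v).filter fun w => Disjoint X (children G v w) := by
  simp only [Free, not_forall, not_not] at hZ
  obtain ⟨v, hvZ, hadj⟩ := hZ
  refine ⟨v, Finset.mem_sdiff.mpr ⟨hvZ, fun hvX => hX v hvX hadj⟩, Finset.mem_filter.mpr
    ⟨(G.mem_neighborFinset v w).mpr hadj.symm, Finset.disjoint_left.mpr fun u hu hu' => ?_⟩⟩
  exact hX u hu (mem_children.mp hu').2

lemma mul_card_mismatch_le [DecidableRel G.Adj] {lam K : ℝ} (hlam : 0 ≤ lam)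
    {X Z : IndepSets G} (hX : ∀ v, lam * unblocked G X.1 v ≤ K)
    (hZ : ∀ v, lam * unblocked G Z.1 v ≤ K) :
    lam * (mismatch (X, Z)).card ≤ K * hamming (X, Z) := by
  set N : Finset V → V → Finset V := fun Y v =>
    (G.neighborFinset v).filter fun w => Disjoint Y (children G v w)
  have hsub : mismatch (X, Z) ⊆
      (symmDiff X.1 Z.1).biUnion fun v => if v ∈ Z.1 then N X.1 v else N Z.1 v := by
    intro w hw
    have hw : ¬ (Free G X.1 w ↔ Free G Z.1 w) := by simpa [mismatch] using hw
    rw [Finset.mem_biUnion]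
    by_cases hfree : Free G X.1 w
    · obtain ⟨v, hv, hwv⟩ := exists_unblocked_of_free hfree (by tauto : ¬ Free G Z.1 w)
      have hvZ := (Finset.mem_sdiff.mp hv).1
      exact ⟨v, Finset.mem_union_right _ hv, by rwa [if_pos hvZ]⟩
    · obtain ⟨v, hv, hwv⟩ := exists_unblocked_of_free (by tauto : Free G Z.1 w) hfree
      have hvZ := (Finset.mem_sdiff.mp hv).2
      exact ⟨v, Finset.mem_union_left _ hv, by rwa [if_neg hvZ]⟩
  have hcard : ((mismatch (X, Z)).card : ℝ) ≤
      ∑ v ∈ symmDiff X.1 Z.1, ((if v ∈ Z.1 then N X.1 v else N Z.1 v).card : ℝ) :=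
    mod_cast (Finset.card_le_card hsub).trans Finset.card_biUnion_le
  calc lam * (mismatch (X, Z)).card
      ≤ ∑ v ∈ symmDiff X.1 Z.1, lam * ((if v ∈ Z.1 then N X.1 v else N Z.1 v).card : ℝ) := by
        rw [← Finset.mul_sum]
        exact mul_le_mul_of_nonneg_left hcard hlam
    _ ≤ (symmDiff X.1 Z.1).card • K := by
        refine Finset.sum_le_card_nsmul _ _ _ fun v _ => ?_
        split_ifs
        · exact hX v
        · exact hZ v
    _ = K * hamming (X, Z) := by rw [nsmul_eq_mul, mul_comm, hamming]

variable [Nonempty V]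

variable (G) in
/-- The identical coupling of the Glauber dynamics: both chains choose the same vertex and the
same coin. -/
noncomputable def couple (lam : ℝ) (p : IndepSets G × IndepSets G) :
    PMF (IndepSets G × IndepSets G) :=
  (randomUpdate V lam).map fun q => (update G p.1 q.1 q.2, update G p.2 q.1 q.2)

lemma isCoupling_couple (lam : ℝ) : IsCoupling (couple G lam) (glauberStep G lam) where
  map_fst p := by rw [couple, PMF.map_comp, glauberStep_eq_map]; rfl
  map_snd p := by rw [couple, PMF.map_comp, glauberStep_eq_map]; rfl

lemma expect_couple_hamming_le {lam : ℝ} (h : 0 ≤ lam) (p : IndepSets G × IndepSets G) :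
    expect (couple G lam p) hamming ≤
      hamming p - (hamming p - lam * (mismatch p).card) / Fintype.card V := by
  classical
  obtain ⟨X, Z⟩ := p
  have : (0 : ℝ) < Fintype.card V := Nat.cast_pos.mpr Fintype.card_pos
  have : 0 < 1 + lam := by linarith
  have hvertex (v : V) : lam / (1 + lam) * hamming (update G X v true, update G Z v true) +
        1 / (1 + lam) * hamming (update G X v false, update G Z v false) ≤
      hamming (X, Z) - (if v ∈ symmDiff X.1 Z.1 then 1 else 0) +
        lam * if ¬ (Free G X.1 v ↔ Free G Z.1 v) then 1 else 0 := by
    have htrue := hamming_update_le X Z v true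
    have hfalse := hamming_update_le X Z v false
    simp only [true_and, Bool.false_eq_true, false_and, if_false, add_zero] at htrue hfalse
    set e : ℝ := if ¬ (Free G X.1 v ↔ Free G Z.1 v) then 1 else 0
    have : 0 ≤ e := by positivity
    calc _ ≤ lam / (1 + lam) * (hamming (X, Z) - (if v ∈ symmDiff X.1 Z.1 then 1 else 0) + e) +
          1 / (1 + lam) * (hamming (X, Z) - if v ∈ symmDiff X.1 Z.1 then 1 else 0) := by gcongr
      _ = hamming (X, Z) - (if v ∈ symmDiff X.1 Z.1 then 1 else 0) + lam / (1 + lam) * e := by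
          field_simp
          ring
      _ ≤ _ := by gcongr; exact div_le_self h (by linarith)
  rw [couple, expect_map, expect_randomUpdate h]
  calc _ ≤ 1 / (Fintype.card V : ℝ) * ∑ v, (hamming (X, Z) -
        (if v ∈ symmDiff X.1 Z.1 then 1 else 0) +
        lam * if ¬ (Free G X.1 v ↔ Free G Z.1 v) then 1 else 0) :=
        mul_le_mul_of_nonneg_left (Finset.sum_le_sum fun v _ => hvertex v) (by positivity)
    _ = 1 / (Fintype.card V : ℝ) * (Fintype.card V * hamming (X, Z) - hamming (X, Z) +
        lam * (mismatch (X, Z)).card) := by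
        rw [Finset.sum_add_distrib, Finset.sum_sub_distrib, Finset.sum_const, Finset.card_univ,
          nsmul_eq_mul, Finset.sum_boole, ← Finset.mul_sum, Finset.sum_boole,
          Finset.filter_mem_eq_inter, Finset.univ_inter]
        rfl
    _ = _ := by field_simp; ring

lemma expect_couple_hamming_contract [DecidableRel G.Adj] {lam ε : ℝ} (h : 0 ≤ lam)
    {X Z : IndepSets G} (hX : ∀ v, lam * unblocked G X.1 v ≤ 1 - ε)
    (hZ : ∀ v, lam * unblocked G Z.1 v ≤ 1 - ε) :
    expect (couple G lam (X, Z)) hamming ≤ (1 - ε / Fintype.card V) * hamming (X, Z) := by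
  refine (expect_couple_hamming_le h (X, Z)).trans ?_
  have hmis := mul_card_mismatch_le h hX hZ
  calc _ ≤ hamming (X, Z) - (hamming (X, Z) - (1 - ε) * hamming (X, Z)) / Fintype.card V := by
        gcongr
    _ = _ := by ring

end IdenticalCoupling

section Annealing

variable {V : Type} [Fintype V] [DecidableEq V] [Nonempty V] {G : SimpleGraph V}
  [DecidableRel G.Adj] {ε κ η lam : ℝ} {Δ : ℕ}

/-- The contribution of the atypical independent sets, at which the identical coupling need not
contract, to the error of one stage of annealing on a `Δ`-regular graph with `n` vertices. -/
noncomputable def atypicalError (n : ℕ) (ε η : ℝ) (Δ : ℕ) : ℝ :=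
  16 * n ^ 3 * ((2 + Real.exp 6) * Real.exp (-(η ^ 2 / 4 * Δ))) / ε

lemma dTV_bind_glauber_le (hg : 6 ≤ G.egirth) (hreg : G.IsRegularOfDegree Δ) (hε : 0 < ε)
    (hε1 : ε < 1) (hgap : TwoStepGap ε κ) (hη : 0 < η) (hη7 : 7 * η ≤ 1) (hηκ : 48 * η < κ)
    (hlam : 0 ≤ lam) (hlamη : lam ≤ η) (hc : lam * Δ ≤ (1 - ε) * Real.exp 1)
    {μ : PMF (IndepSets G)} (hwarm : IsWarm 3 μ (gibbsPMF G lam hlam)) (T : ℕ) :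
    dTV (μ.bind (glauber G lam T)) (gibbsPMF G lam hlam) ≤
      Fintype.card V * (1 - ε / (4 * Fintype.card V)) ^ T +
        atypicalError (Fintype.card V) ε η Δ := by
  have hn : (1 : ℝ) ≤ Fintype.card V := Nat.one_le_cast.mpr Fintype.card_pos
  have hc3 : lam * Δ ≤ 3 := by
    have := Real.exp_one_lt_d9
    nlinarith [Real.exp_pos 1]
  have hr0 : ε / (4 * Fintype.card V) ≤ 1 := (div_le_one (by linarith)).mpr (by linarith)
  have hr1 : 0 < ε / (4 * Fintype.card V) := by positivity
  set B : Set (IndepSets G) := {X | ∃ v, ¬ TypicalAt G lam η X.1 v}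
  have hunblocked {X : IndepSets G} (hX : X ∉ B) (v : V) :
      lam * unblocked G X.1 v ≤ 1 - ε / 4 :=
    lam_mul_unblocked_le hreg hgap hη7 hηκ hlam hlamη hc hc3 (by simpa [B] using hX) v
  have hB := prob_exists_not_typicalAt_le hg hlam hc3 hη (by linarith) hreg
  rw [bind_glauber]
  refine (dTV_iterate_le_of_contraction (B := B) (isCoupling_couple lam) (sub_nonneg.mpr hr0)
    (sub_lt_self 1 hr1) hamming_nonneg (fun _ => one_le_hamming) hamming_le_card
    (fun X Z hX hZ => ?_) hwarm (gibbsPMF_bind_glauberStep hlam) T).trans ?_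
  · rw [← div_div]
    exact expect_couple_hamming_contract hlam (hunblocked hX) (hunblocked hZ)
  · gcongr
    calc _ ≤ (Fintype.card V : ℝ) * ((3 + 1) * (Fintype.card V * ((2 + Real.exp 6) *
          Real.exp (-(η ^ 2 / 4 * Δ))))) / (1 - (1 - ε / (4 * Fintype.card V))) := by
          rw [sub_sub_cancel, NNReal.coe_ofNat]
          gcongr
      _ = atypicalError (Fintype.card V) ε η Δ := by
          rw [atypicalError, sub_sub_cancel]
          field_simp
          ring

lemma dTV_annealing_le (hg : 6 ≤ G.egirth) (hreg : G.IsRegularOfDegree Δ) (hε : 0 < ε)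
    (hε1 : ε < 1) (hgap : TwoStepGap ε κ) (hη : 0 < η) (hη7 : 7 * η ≤ 1) (hηκ : 48 * η < κ)
    (hlam : 0 ≤ lam) (hlamη : lam ≤ η) (hc : lam * Δ ≤ (1 - ε) * Real.exp 1) (T : ℕ) {k : ℕ}
    (hk0 : 0 < k) (hk : lam * Fintype.card V ≤ k) {i : ℕ} (hi : i ≤ k) :
    dTV (annealing G (fun j => j * lam / k) (fun _ => T) i)
        (gibbsPMF G (i * lam / k) (by positivity)) ≤
      i * (Fintype.card V * (1 - ε / (4 * Fintype.card V)) ^ T +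
        atypicalError (Fintype.card V) ε η Δ) := by
  have hk0' : (0 : ℝ) < k := Nat.cast_pos.mpr hk0
  induction i with
  | zero =>
    have hzero {x : ℝ} (hx : 0 ≤ x) (h0 : x = 0) :
        gibbsPMF G x hx = PMF.pure (emptySet G) := by
      subst h0
      exact gibbsPMF_zero
    rw [hzero _ (by simp), annealing, dTV_self]
    simp
  | succ i ih =>
    have hle : ((i + 1 : ℕ) : ℝ) * lam / k ≤ lam := by
      rw [div_le_iff₀ hk0', mul_comm lam]
      gcongr
    have hdiff : ((i + 1 : ℕ) : ℝ) * lam / k - i * lam / k = lam / k := by push_cast; ring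
    have hmono : (i : ℝ) * lam / k ≤ ((i + 1 : ℕ) : ℝ) * lam / k := by gcongr; simp
    have hwarm := isWarm_gibbs (G := G) (by positivity : 0 ≤ (i : ℝ) * lam / k) hmono
      (by rwa [hdiff, div_mul_eq_mul_div, div_le_one hk0'])
    have hstage := dTV_bind_glauber_le hg hreg hε hε1 hgap hη hη7 hηκ (by positivity)
      (hle.trans hlamη) ((mul_le_mul_of_nonneg_right hle (Nat.cast_nonneg _)).trans hc) hwarm T
    refine (dTV_triangle _ _ _).trans ((add_le_add ((dTV_bind_le _ _ _).trans
      (ih (by lia))) hstage).trans_eq ?_)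
    push_cast
    ring

end Annealing

end HardCore

namespace RealRAM

section Semantics

variable {E : ℕ → ℕ → Prop} {α β : Type}

lemma run_instr (t : ℕ) (i : Instr) (K : List Prog) (s : Store) :
    run E (t + 1) (.instr i :: K, s) = (i.exec E s).bind fun s' => run E t (K, s') := by
  rw [run, step, PMF.bind_map]
  rfl

lemma run_seq (t : ℕ) (P Q : Prog) (K : List Prog) (s : Store) :
    run E (t + 1) (.seq P Q :: K, s) = run E t (P :: Q :: K, s) := by
  rw [run, step, PMF.pure_bind]

lemma run_loop_of_holds {b : Test} {s : Store} (h : b.holds s) (t : ℕ) (P : Prog)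
    (K : List Prog) : run E (t + 1) (.loop b P :: K, s) = run E t (P :: .loop b P :: K, s) := by
  rw [run, step, PMF.pure_bind, if_pos h]

lemma run_loop_of_not_holds {b : Test} {s : Store} (h : ¬ b.holds s) (t : ℕ) (P : Prog)
    (K : List Prog) : run E (t + 1) (.loop b P :: K, s) = run E t (K, s) := by
  rw [run, step, PMF.pure_bind, if_neg h]

/-- A straight-line program. -/
def block : List Instr → Prog
  | [] => .skip
  | i :: l => .seq (.instr i) (block l)

/-- The law of the store after the instructions of a straight-line program. -/
noncomputable def execAll (E : ℕ → ℕ → Prop) : List Instr → Store → PMF Store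
  | [], s => PMF.pure s
  | i :: l, s => (i.exec E s).bind (execAll E l)

lemma run_block (l : List Instr) (t : ℕ) (K : List Prog) (s : Store) :
    run E (2 * l.length + 1 + t) (block l :: K, s) =
      (execAll E l s).bind fun s' => run E t (K, s') := by
  induction l generalizing s with
  | nil => rw [List.length_nil, Nat.add_comm, run, block, step, execAll, PMF.pure_bind,
      PMF.pure_bind]
  | cons i l ih =>
    rw [show 2 * (i :: l).length + 1 + t = 2 * l.length + 1 + t + 1 + 1 by
      rw [List.length_cons]; ring, block, run_seq, run_instr, execAll, PMF.bind_bind]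
    exact congrArg _ (funext ih)

/-- Started at `s`, the program `P` terminates after exactly `t` steps, and its effect is a random
`a` with law `ρ` together with a store that is related to `a` by `R`. It is phrased for an
arbitrary continuation `K` and observable `out`, so that it composes without constructing the
joint law of `a` and the store. -/
def Simulates (E : ℕ → ℕ → Prop) (P : Prog) (s : Store) (t : ℕ) (ρ : PMF α)
    (R : α → Store → Prop) : Prop :=
  ∀ ⦃γ : Type⦄ (out : Config → γ) (K : List Prog) (t' : ℕ) (Ψ : α → PMF γ),
    (∀ a s', R a s' → (run E t' (K, s')).map out = Ψ a) →
      (run E (t + t') (P :: K, s)).map out = ρ.bind Ψ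

variable {s : Store} {P Q : Prog} {t t' : ℕ} {R : α → Store → Prop} {R' : β → Store → Prop}

lemma simulates_block {l : List Instr} {ρ : PMF α} {g : α → Store}
    (hl : execAll E l s = ρ.map g) (hR : ∀ a, R a (g a)) :
    Simulates E (block l) s (2 * l.length + 1) ρ R := by
  intro γ out K t' Ψ hΨ
  rw [run_block, hl, PMF.bind_map, PMF.map_bind]
  exact congrArg _ (funext fun a => hΨ a _ (hR a))

lemma simulates_block_pure {l : List Instr} {s' : Store} (hl : execAll E l s = PMF.pure s')
    {a : α} (hR : R a s') : Simulates E (block l) s (2 * l.length + 1) (PMF.pure a) R := by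
  intro γ out K t' Ψ hΨ
  rw [run_block, hl, PMF.pure_bind, PMF.pure_bind, hΨ a s' hR]

lemma Simulates.mono {ρ : PMF α} {R' : α → Store → Prop} (hP : Simulates E P s t ρ R)
    (h : ∀ a s', R a s' → R' a s') : Simulates E P s t ρ R' :=
  fun _ out K t' Ψ hΨ => hP out K t' Ψ fun a s' hR => hΨ a s' (h a s' hR)

lemma Simulates.seq {ρ : PMF α} {ρ' : α → PMF β} (hP : Simulates E P s t ρ R)
    (hQ : ∀ a s', R a s' → Simulates E Q s' t' (ρ' a) R') :
    Simulates E (.seq P Q) s (1 + t + t') (ρ.bind ρ') R' := by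
  intro γ out K t₀ Ψ hΨ
  rw [show 1 + t + t' + t₀ = t + (t' + t₀) + 1 by ring, run_seq, PMF.bind_bind]
  exact hP out _ _ _ fun a s' h => hQ a s' h out K t₀ Ψ hΨ

lemma simulates_loop {b : Test} {κ : ℕ → α → PMF α} {R : ℕ → α → Store → Prop} {T : ℕ} {a : α}
    (hguard : ∀ j ≤ T, ∀ a s, R j a s → (b.holds s ↔ j < T))
    (hbody : ∀ j < T, ∀ a s, R j a s → Simulates E P s t (κ j a) (R (j + 1))) (h : R 0 a s) :
    Simulates E (.loop b P) s ((t + 1) * T + 1) (HardCore.chain κ a T) (R T) := by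
  intro γ out K t' Ψ hΨ
  have hiter (j : ℕ) (hj : j ≤ T) : ∀ (t' : ℕ) (Ψ : α → PMF γ),
      (∀ a s', R j a s' → (run E t' (.loop b P :: K, s')).map out = Ψ a) →
      (run E ((t + 1) * j + t') (.loop b P :: K, s)).map out = (HardCore.chain κ a j).bind Ψ := by
    induction j with
    | zero =>
      intro t' Ψ hΨ
      rw [mul_zero, zero_add, HardCore.chain, PMF.pure_bind, hΨ a s h]
    | succ j ih =>
      intro t' Ψ hΨ
      rw [show (t + 1) * (j + 1) + t' = (t + 1) * j + (t + t' + 1) by ring, HardCore.chain,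
        PMF.bind_bind]
      refine ih (by lia) _ _ fun a s' hR => ?_
      rw [run_loop_of_holds ((hguard j (by lia) a s' hR).mpr hj)]
      exact hbody j hj a s' hR out _ t' Ψ hΨ
  rw [add_assoc]
  refine hiter T le_rfl _ Ψ fun a s' hR => ?_
  rw [Nat.add_comm, run_loop_of_not_holds (by simp [hguard T le_rfl a s' hR]), hΨ a s' hR]

lemma uniformBelow_eq_map (n : ℕ) [NeZero n] :
    uniformBelow n = (PMF.uniformOfFintype (Fin n)).map Fin.val := by
  have hne : (Finset.range n).Nonempty := Finset.nonempty_range_iff.mpr (NeZero.ne n)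
  ext x
  rw [uniformBelow, dif_pos hne, PMF.uniformOfFinset_apply, PMF.map_apply, tsum_fintype]
  by_cases hx : x < n
  · rw [Finset.sum_eq_single (⟨x, hx⟩ : Fin n)]
    · simp [hx]
    · exact fun v _ hv => if_neg fun h => hv (Fin.ext h.symm)
    · simp
  · rw [Finset.sum_eq_zero]
    · simp [hx]
    · exact fun v _ => if_neg (by rintro rfl; exact hx v.2)

end Semantics

section Store

variable (s : Store) (r k x : ℕ) (y : ℝ)

@[simp] lemma Store.nat_setNat : (s.setNat r x).nat k = if k = r then x else s.nat k :=
  Function.update_apply ..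

@[simp] lemma Store.real_setNat : (s.setNat r x).real = s.real := rfl

@[simp] lemma Store.mem_setNat : (s.setNat r x).mem = s.mem := rfl

@[simp] lemma Store.nat_setReal : (s.setReal r y).nat = s.nat := rfl

@[simp] lemma Store.real_setReal : (s.setReal r y).real k = if k = r then y else s.real k :=
  Function.update_apply ..

@[simp] lemma Store.mem_setReal : (s.setReal r y).mem = s.mem := rfl

@[simp] lemma Store.mem_setMem : (s.setMem r x).mem k = if k = r then x else s.mem k :=
  Function.update_apply ..

end Store

section Programs

/-- A vertex (register 5) and a bit (register 6, with the bias in real register 7) are chosen, and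
the counter in real register 8 is multiplied by `r`. -/
def choiceProg : Prog :=
  block [.rmul 8 8 6, .unif 5 0, .flip 6 7, .const 4 0, .const 7 0]

/-- Adds one to register 7 if the vertex in register 4 is an occupied neighbour of the vertex in
register 5, and moves on to the next vertex. The truncated subtraction makes register 8 the
product of the two bits. -/
def scanBody : Prog :=
  block [.edge 8 5 4, .load 9 4, .add 8 8 9, .sub 8 8 1, .add 7 7 8, .add 4 4 1]

/-- The chosen bit is stored at the chosen vertex, or zero if the vertex has an occupied
neighbour. -/
def updateProg : Prog :=
  block [.sub 6 6 7, .store 5 6]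

/-- One step of the Glauber dynamics. -/
def glauberProg : Prog :=
  .seq choiceProg (.seq (.loop (.natLt 4 0) scanBody) updateProg)

/-- The next fugacity and from it the bias of the coin are computed, and the counter in real
register 8 is set to `q`. -/
def stageSetupProg : Prog :=
  block [.add 3 3 1, .ofNat 9 3, .rmul 9 9 0, .rdiv 9 9 4, .radd 7 3 9, .rdiv 7 9 7, .rmul 8 5 3]

/-- One stage of simulated annealing: Glauber steps are made until the counter is at most one. -/
def stageProg : Prog :=
  .seq stageSetupProg (.loop (.realLt 3 8) glauberProg)

/-- Initialization of the registers that `Represents` describes. -/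
def setupProg : Prog :=
  block [.const 1 1, .add 2 0 0, .add 2 2 0, .add 4 2 2, .ofNat 3 1, .ofNat 4 2, .ofNat 5 4,
    .ofNat 7 0, .rmul 5 5 7, .rdiv 5 5 1, .radd 6 7 7, .radd 6 6 6, .rdiv 6 2 6, .rsub 6 3 6]

/-- Simulated annealing in `3 * n` stages. -/
def annealProg : Prog := .seq setupProg (.loop (.natLt 3 2) stageProg)

/-- The store represents the set `X` after `i` stages of annealing. The natural number registers
from 4 and the real registers from 7 are scratch space. -/
structure Represents (n : ℕ) (lam q r : ℝ) (i : ℕ) (X : Finset (Fin n)) (s : Store) : Prop where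
  nat0 : s.nat 0 = n
  nat1 : s.nat 1 = 1
  nat2 : s.nat 2 = 3 * n
  nat3 : s.nat 3 = i
  real0 : s.real 0 = lam
  real3 : s.real 3 = 1
  real4 : s.real 4 = 3 * n
  real5 : s.real 5 = q
  real6 : s.real 6 = r
  mem : ∀ v : Fin n, s.mem v = if v ∈ X then 1 else 0

/-- The store represents the set `X` during a stage of annealing with insertion probability `p`
in which the counter has the value `x`. -/
structure InStage (n : ℕ) (lam q r : ℝ) (i : ℕ) (p x : ℝ) (X : Finset (Fin n)) (s : Store) : Prop
    extends Represents n lam q r i X s where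
  real7 : s.real 7 = p
  real8 : s.real 8 = x

/-- The store during the scan of the neighbours in a Glauber step: the vertex `v` and the bit `b`
have been chosen, and the vertices below `u` have been scanned for occupied neighbours of `v`. -/
structure InScan {n : ℕ} (lam q r : ℝ) (i : ℕ) (p x : ℝ) (G : SimpleGraph (Fin n))
    (X : Finset (Fin n)) (v : Fin n) (b : Bool) (u : ℕ) (s : Store) : Prop
    extends InStage n lam q r i p x X s where
  nat4 : s.nat 4 = u
  nat5 : s.nat 5 = v
  nat6 : s.nat 6 = if b then 1 else 0
  nat7 : s.nat 7 = 0 ↔ ∀ w ∈ X, (w : ℕ) < u → ¬ G.Adj v w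

end Programs

section Correctness

variable {n : ℕ} {lam q r p x : ℝ} {i : ℕ} {G : SimpleGraph (Fin n)} {s : Store}

lemma Represents.setNat {X : Finset (Fin n)} (h : Represents n lam q r i X s) {k : ℕ}
    (hk : 4 ≤ k) (m : ℕ) : Represents n lam q r i X (s.setNat k m) := by
  obtain ⟨h0, h1, h2, h3, h4, h5, h6, h7, h8, hm⟩ := h
  constructor
  · simpa [show 0 ≠ k by lia]
  · simpa [show 1 ≠ k by lia]
  · simpa [show 2 ≠ k by lia]
  · simpa [show 3 ≠ k by lia]
  all_goals assumption

lemma Represents.setReal {X : Finset (Fin n)} (h : Represents n lam q r i X s) {k : ℕ}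
    (hk : 7 ≤ k) (y : ℝ) : Represents n lam q r i X (s.setReal k y) := by
  obtain ⟨h0, h1, h2, h3, h4, h5, h6, h7, h8, hm⟩ := h
  constructor
  · exact h0
  · exact h1
  · exact h2
  · exact h3
  · simpa [show 0 ≠ k by lia]
  · simpa [show 3 ≠ k by lia]
  · simpa [show 4 ≠ k by lia]
  · simpa [show 5 ≠ k by lia]
  · simpa [show 6 ≠ k by lia]
  · exact hm

lemma Represents.nextStage {X : Finset (Fin n)} (h : Represents n lam q r i X s) :
    Represents n lam q r (i + 1) X (s.setNat 3 (i + 1)) where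
  __ := h
  nat0 := by simp [h.nat0]
  nat1 := by simp [h.nat1]
  nat2 := by simp [h.nat2]
  nat3 := by simp

lemma InStage.setNat {X : Finset (Fin n)} (h : InStage n lam q r i p x X s) {k : ℕ}
    (hk : 4 ≤ k) (m : ℕ) : InStage n lam q r i p x X (s.setNat k m) :=
  ⟨h.toRepresents.setNat hk m, h.real7, h.real8⟩

lemma simulates_scanBody {X : Finset (Fin n)} {v : Fin n} {b : Bool} {u : ℕ} (hu : u < n)
    (h : InScan lam q r i p x G X v b u s) :
    Simulates (edges G) scanBody s 13 (PMF.pure ())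
      (fun _ => InScan lam q r i p x G X v b (u + 1)) := by
  classical
  set w : Fin n := ⟨u, hu⟩
  have hedge : edges G v u ↔ G.Adj v w := by simp [edges, hu, w]
  have hmem : s.mem u = if w ∈ X then 1 else 0 := h.mem w
  refine simulates_block_pure (by simp [execAll, Instr.exec, PMF.pure_bind]; rfl)
    ⟨?_, ?_, ?_, ?_, ?_⟩
  · iterate 6 refine InStage.setNat ?_ (by norm_num) _
    exact h.toInStage
  · simp [h.nat4, h.nat1]
  · simp [h.nat5]
  · simp [h.nat6]
  · have hsplit : (∀ w' ∈ X, (w' : ℕ) < u + 1 → ¬ G.Adj v w') ↔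
        (∀ w' ∈ X, (w' : ℕ) < u → ¬ G.Adj v w') ∧ (w ∈ X → ¬ G.Adj v w) := by
      refine ⟨fun h => ⟨fun w' hw' hlt => h w' hw' (by lia), fun hw => h w hw u.lt_succ_self⟩,
        fun ⟨hlt, heq⟩ w' hw' hle => ?_⟩
      obtain hw | hw := Nat.lt_succ_iff_lt_or_eq.mp hle
      · exact hlt w' hw' hw
      · obtain rfl : w' = w := Fin.ext hw
        exact heq hw'
    rw [hsplit, ← h.nat7]
    by_cases hadj : G.Adj v w <;> by_cases hw : w ∈ X <;>
      simp [h.nat1, h.nat4, h.nat5, hedge, hmem, hadj, hw]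

lemma simulates_choiceProg [NeZero n] {X : Finset (Fin n)} {f : ℝ}
    (h : InStage n lam q r i (f / (1 + f)) x X s) :
    Simulates (edges G) choiceProg s 11 (HardCore.randomUpdate (Fin n) f)
      (fun c => InScan lam q r i (f / (1 + f)) (x * r) G X c.1 c.2 0) := by
  refine simulates_block (g := fun c => ((((s.setReal 8 (s.real 8 * s.real 6)).setNat 5
    c.1).setNat 6 (if c.2 then 1 else 0)).setNat 4 0).setNat 7 0) ?_ fun c => ⟨?_, ?_, ?_, ?_, ?_⟩
  · simp [execAll, Instr.exec, uniformBelow_eq_map, h.nat0, h.real7, HardCore.randomUpdate,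
      PMF.pure_bind, ← PMF.bind_pure_comp, Function.comp_def]
  · iterate 4 refine InStage.setNat ?_ (by norm_num) _
    exact ⟨h.toRepresents.setReal (by norm_num) _, by simp [h.real7], by simp [h.real8, h.real6]⟩
  all_goals simp

lemma simulates_scanLoop {X : Finset (Fin n)} {v : Fin n} {b : Bool}
    (h : InScan lam q r i p x G X v b 0 s) :
    Simulates (edges G) (.loop (.natLt 4 0) scanBody) s (14 * n + 1) (PMF.pure ())
      (fun _ => InScan lam q r i p x G X v b n) := by
  have hchain : ∀ m, HardCore.chain (fun _ => PMF.pure) () m = PMF.pure () := fun m => by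
    induction m with
    | zero => rfl
    | succ m ih => rw [HardCore.chain, ih, PMF.pure_bind]
  rw [← hchain n]
  exact simulates_loop (R := fun u _ => InScan lam q r i p x G X v b u)
    (fun u _ _ s hs => by rw [Test.holds, hs.nat4, hs.nat0])
    (fun u hu _ s hs => simulates_scanBody hu hs) h

lemma InScan.nat7_eq_zero_iff_free {X : Finset (Fin n)} {v : Fin n} {b : Bool}
    (h : InScan lam q r i p x G X v b n s) : s.nat 7 = 0 ↔ HardCore.Free G X v := by
  simp [h.nat7, HardCore.Free]

lemma simulates_updateProg {X : HardCore.IndepSets G} {v : Fin n} {b : Bool}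
    (h : InScan lam q r i p x G X.1 v b n s) :
    Simulates (edges G) updateProg s 5 (PMF.pure (HardCore.update G X v b))
      (fun Y => InStage n lam q r i p x Y.1) := by
  classical
  have h' := h.toInStage.setNat (k := 6) (by norm_num) (s.nat 6 - s.nat 7)
  refine simulates_block_pure
    (s' := (s.setNat 6 (s.nat 6 - s.nat 7)).setMem (s.nat 5) (s.nat 6 - s.nat 7))
    (by simp [execAll, Instr.exec, PMF.pure_bind])
    ⟨⟨h'.nat0, h'.nat1, h'.nat2, h'.nat3, h'.real0, h'.real3, h'.real4, h'.real5, h'.real6,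
      fun w => ?_⟩, h'.real7, h'.real8⟩
  have hbit : s.nat 6 - s.nat 7 = if b = true ∧ HardCore.Free G X.1 v then 1 else 0 := by
    rw [← h.nat7_eq_zero_iff_free, h.nat6]
    grind
  rw [if_congr (HardCore.mem_update X v w b) rfl rfl]
  by_cases hw : w = v <;> simp [hw, h.nat5, hbit, h.mem, Fin.val_inj]

lemma simulates_glauberProg [NeZero n] {X : HardCore.IndepSets G} {f : ℝ}
    (h : InStage n lam q r i (f / (1 + f)) x X.1 s) :
    Simulates (edges G) glauberProg s (14 * n + 19) (HardCore.glauberStep G f X)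
      (fun Y => InStage n lam q r i (f / (1 + f)) (x * r) Y.1) := by
  have hseq := (simulates_choiceProg h).seq fun _ _ hc =>
    (simulates_scanLoop hc).seq fun _ _ hs => simulates_updateProg (X := X) hs
  rw [HardCore.glauberStep_eq_map, ← PMF.bind_pure_comp]
  simp only [PMF.pure_bind] at hseq
  rwa [show 1 + 11 + (1 + (14 * n + 1) + 5) = 14 * n + 19 by ring] at hseq

lemma simulates_stageSetupProg {X : HardCore.IndepSets G} (h : Represents n lam q r i X.1 s)
    {f : ℝ} (hf : f = (i + 1 : ℕ) * lam / (3 * n : ℕ)) :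
    Simulates (edges G) stageSetupProg s 15 (PMF.pure X)
      (fun X => InStage n lam q r (i + 1) (f / (1 + f)) (q * r ^ 0) X.1) := by
  refine simulates_block_pure (by simp [execAll, Instr.exec, PMF.pure_bind]; rfl) ⟨?_, ?_, ?_⟩
  · iterate 6 refine Represents.setReal ?_ (by norm_num) _
    simpa [h.nat1, h.nat3] using h.nextStage
  · simp [h.nat1, h.nat3, h.real0, h.real3, h.real4, hf]
  · simp [h.real3, h.real5]

lemma simulates_glauberLoop [NeZero n] {X : HardCore.IndepSets G} {f : ℝ} {T : ℕ}
    (hT : ∀ j ≤ T, (1 < q * r ^ j ↔ j < T))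
    (h : InStage n lam q r i (f / (1 + f)) (q * r ^ 0) X.1 s) :
    Simulates (edges G) (.loop (.realLt 3 8) glauberProg) s ((14 * n + 20) * T + 1)
      (HardCore.glauber G f T X) (fun Y => Represents n lam q r i Y.1) := by
  rw [HardCore.glauber_eq_chain]
  refine (simulates_loop
    (R := fun j (Y : HardCore.IndepSets G) => InStage n lam q r i (f / (1 + f)) (q * r ^ j) Y.1)
    (fun j hj Y s hs => ?_) (fun _ _ Y s hs => ?_) h).mono fun Y s hs => hs.toRepresents
  · rw [Test.holds, hs.real3, hs.real8, hT j hj]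
  · simpa only [pow_succ, mul_assoc] using simulates_glauberProg hs

lemma simulates_stageProg [NeZero n] {X : HardCore.IndepSets G} {T : ℕ}
    (hT : ∀ j ≤ T, (1 < q * r ^ j ↔ j < T)) (h : Represents n lam q r i X.1 s) :
    Simulates (edges G) stageProg s ((14 * n + 20) * T + 17)
      (HardCore.glauber G ((i + 1 : ℕ) * lam / (3 * n : ℕ)) T X)
      (fun Y => Represents n lam q r (i + 1) Y.1) := by
  have hseq := (simulates_stageSetupProg h rfl).seq fun _ _ hs => simulates_glauberLoop hT hs
  rwa [PMF.pure_bind, show 1 + 15 + ((14 * n + 20) * T + 1) = (14 * n + 20) * T + 17 by ring]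
    at hseq

lemma simulates_setupProg (G : SimpleGraph (Fin n)) (lam δ ε : ℝ) :
    Simulates (edges G) setupProg (initStore n lam δ ε) 29 (PMF.pure (HardCore.emptySet G))
      (fun X => Represents n lam (6 * n * n / δ) (1 - ε / (4 * n)) 0 X.1) := by
  refine simulates_block_pure (by simp [execAll, Instr.exec, PMF.pure_bind]; rfl)
    ⟨?_, ?_, ?_, ?_, ?_, ?_, ?_, ?_, ?_, ?_⟩
  all_goals simp [initStore, HardCore.emptySet]
  all_goals ring_nf

lemma simulates_annealProg [NeZero n] {δ ε : ℝ} {T : ℕ}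
    (hT : ∀ j ≤ T, (1 < 6 * n * n / δ * (1 - ε / (4 * n)) ^ j ↔ j < T)) :
    Simulates (edges G) annealProg (initStore n lam δ ε)
      (((14 * n + 20) * T + 18) * (3 * n) + 31)
      (HardCore.annealing G (fun j => j * lam / (3 * n : ℕ)) (fun _ => T) (3 * n))
      (fun X => Represents n lam (6 * n * n / δ) (1 - ε / (4 * n)) (3 * n) X.1) := by
  rw [HardCore.annealing_eq_chain]
  have hseq := (simulates_setupProg G lam δ ε).seq fun _ _ h => simulates_loop
    (b := .natLt 3 2) (T := 3 * n)
    (R := fun i (X : HardCore.IndepSets G) =>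
      Represents n lam (6 * n * n / δ) (1 - ε / (4 * n)) i X.1)
    (fun i _ X s hs => by rw [Test.holds, hs.nat3, hs.nat2])
    (fun i _ X s hs => simulates_stageProg hT hs) h
  rw [PMF.pure_bind] at hseq
  rwa [show 1 + 29 + (((14 * n + 20) * T + 17 + 1) * (3 * n) + 1) =
    ((14 * n + 20) * T + 18) * (3 * n) + 31 by ring] at hseq

theorem outputAfter_annealProg [NeZero n] {δ ε : ℝ} {T : ℕ}
    (hT : ∀ j ≤ T, (1 < 6 * n * n / δ * (1 - ε / (4 * n)) ^ j ↔ j < T)) :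
    outputAfter annealProg (((14 * n + 20) * T + 18) * (3 * n) + 31) G lam δ ε =
      (HardCore.annealing G (fun j => j * lam / (3 * n : ℕ)) (fun _ => T) (3 * n)).map
        fun X => some X.1 := by
  rw [outputAfter, ← PMF.bind_pure_comp]
  refine simulates_annealProg hT (output n) [] 0 _ fun X s hs => ?_
  have hX : (Finset.univ.filter fun v : Fin n => s.mem v ≠ 0) = X.1 := by
    ext v
    simp [hs.mem v]
  rw [run, PMF.pure_map, output, hX]
  rfl

end Correctness

end RealRAM

namespace HardCore

section Parameters

variable {ε δ η lam : ℝ} {n Δ : ℕ}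

lemma exists_stepCount {q r : ℝ} (hr0 : 0 < r) (hr1 : r < 1) (hq : 0 < q) :
    ∃ T : ℕ, (∀ j ≤ T, (1 < q * r ^ j ↔ j < T)) ∧ T ≤ 1 + Real.posLog q / (1 - r) := by
  classical
  have hex : ∃ T : ℕ, q * r ^ T ≤ 1 := by
    obtain ⟨T, hT⟩ := exists_pow_lt_of_lt_one (inv_pos.mpr hq) hr1
    exact ⟨T, ((lt_inv_mul_iff₀ hq).mp (by rwa [mul_one])).le⟩
  have hlt {j : ℕ} (hj : j < Nat.find hex) : 1 < q * r ^ j := not_le.mp (Nat.find_min hex hj)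
  refine ⟨Nat.find hex, fun j hj => ⟨fun h => hj.lt_of_ne ?_, hlt⟩, ?_⟩
  · rintro rfl
    exact h.not_ge (Nat.find_spec hex)
  have h1r : 0 < 1 - r := sub_pos.mpr hr1
  obtain h0 | hpos := (Nat.find hex).eq_zero_or_pos
  · rw [h0, Nat.cast_zero]
    have := div_nonneg (Real.posLog_nonneg (x := q)) h1r.le
    linarith
  · obtain ⟨m, hm⟩ := Nat.exists_eq_succ_of_ne_zero hpos.ne'
    have hlog := Real.log_pos (hlt (j := m) (by lia))
    rw [Real.log_mul hq.ne' (pow_pos hr0 m).ne', Real.log_pow] at hlog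
    have hm' : (m : ℝ) ≤ Real.posLog q / (1 - r) := by
      rw [le_div_iff₀ h1r]
      have := mul_le_mul_of_nonneg_left (Real.log_le_sub_one_of_pos hr0) m.cast_nonneg
      linarith [Real.posLog_apply ▸ le_max_right 0 (Real.log q)]
    rw [hm]
    push_cast
    linarith

/-- The polynomial bound on the running time, in the variables `n`, `1 / ε` and `log⁺ (1 / δ)`. -/
noncomputable def runtimePoly : MvPolynomial (Fin 3) ℝ :=
  ((14 * .X 0 + 20) * (1 + 4 * .X 0 * .X 1 * (6 * .X 0 * .X 0 + .X 2)) + 18) * (3 * .X 0) + 31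

lemma runtime_le_eval_runtimePoly [NeZero n] (hε : 0 < ε) {T : ℕ}
    (hT : T ≤ 1 + Real.posLog (6 * n * n / δ) / (1 - (1 - ε / (4 * n)))) :
    ((((14 * n + 20) * T + 18) * (3 * n) + 31 : ℕ) : ℝ) ≤
      MvPolynomial.eval ![(n : ℝ), 1 / ε, Real.posLog (1 / δ)] runtimePoly := by
  have hn : (0 : ℝ) < n := Nat.cast_pos.mpr (NeZero.pos n)
  have hlog : Real.posLog (6 * n * n / δ) ≤ 6 * n * n + Real.posLog (1 / δ) := by
    rw [div_eq_mul_one_div]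
    refine Real.posLog_mul.trans (add_le_add_left (max_le (by positivity) ?_) _)
    exact (Real.log_le_sub_one_of_pos (by positivity)).trans (sub_le_self _ zero_le_one)
  have hT' : (T : ℝ) ≤ 1 + 4 * n * (1 / ε) * (6 * n * n + Real.posLog (1 / δ)) := by
    refine hT.trans (add_le_add_right ?_ 1)
    rw [sub_sub_cancel, div_div_eq_mul_div, div_eq_mul_one_div _ ε, mul_assoc, mul_comm]
    gcongr
  simp only [runtimePoly, map_add, map_mul, map_one, map_ofNat, MvPolynomial.eval_X,
    Matrix.cons_val_zero, Matrix.cons_val_one, Matrix.cons_val]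
  push_cast
  gcongr

/-- The constant `C` of the degree condition `C * log (n / δ) ≤ Δ`. The first term makes the
fugacity small, the second one makes atypical independent sets unlikely. -/
noncomputable def degreeConstant (ε η : ℝ) : ℝ :=
  6 / η + (4 + 2 * Real.log (96 * (2 + Real.exp 6) / ε)) / (η ^ 2 / 4)

lemma log_degreeConstant_nonneg (hε : 0 < ε) (hε1 : ε < 1) :
    0 ≤ Real.log (96 * (2 + Real.exp 6) / ε) :=
  Real.log_nonneg <| (one_le_div hε).mpr (by linarith [Real.exp_pos 6])

lemma degreeConstant_pos (hε : 0 < ε) (hε1 : ε < 1) (hη : 0 < η) : 0 < degreeConstant ε η := by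
  have := log_degreeConstant_nonneg hε hε1
  unfold degreeConstant
  positivity

lemma half_le_log_div (hn : 2 ≤ n) (hδ : 0 < δ) (hδ1 : δ ≤ 1) : 1 / 2 ≤ Real.log (n / δ) := by
  have hnδ : 2 ≤ n / δ :=
    (Nat.ofNat_le_cast.mpr hn).trans (le_div_self n.cast_nonneg hδ hδ1)
  linarith [Real.log_le_log two_pos hnδ, Real.log_two_gt_d9]

lemma three_div_le_degree (hε : 0 < ε) (hε1 : ε < 1) (hη : 0 < η) (hn : 2 ≤ n) (hδ : 0 < δ)
    (hδ1 : δ ≤ 1) (hΔ : degreeConstant ε η * Real.log (n / δ) ≤ Δ) : 3 / η ≤ Δ := by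
  have hlog := log_degreeConstant_nonneg hε hε1
  calc 3 / η = 6 / η * (1 / 2) := by ring
    _ ≤ degreeConstant ε η * Real.log (n / δ) := by
      refine mul_le_mul (le_add_of_nonneg_right (by positivity)) (half_le_log_div hn hδ hδ1)
        (by norm_num) (degreeConstant_pos hε hε1 hη).le
    _ ≤ Δ := hΔ

lemma atypicalError_le (hε : 0 < ε) (hε1 : ε < 1) (hη : 0 < η) (hn : 2 ≤ n) (hδ : 0 < δ)
    (hδ1 : δ ≤ 1) (hΔ : degreeConstant ε η * Real.log (n / δ) ≤ Δ) :
    3 * n * atypicalError n ε η Δ ≤ δ / 2 := by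
  have : (0 : ℝ) < n := by positivity
  set K := 2 + Real.exp 6
  set Q := Real.log (96 * K / ε) with hQ
  set L := Real.log (n / δ) with hL
  have hK0 : 0 < K := by positivity
  have hQ0 : 0 ≤ Q := log_degreeConstant_nonneg hε hε1
  have hL2 : 1 / 2 ≤ L := half_le_log_div hn hδ hδ1
  have hexponent : 4 * L + Q ≤ η ^ 2 / 4 * Δ := calc
    4 * L + Q ≤ (4 + 2 * Q) * L := by nlinarith
    _ = η ^ 2 / 4 * ((4 + 2 * Q) / (η ^ 2 / 4) * L) := by field_simp
    _ ≤ η ^ 2 / 4 * (degreeConstant ε η * L) := by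
      gcongr
      exact le_add_of_nonneg_left (by positivity)
    _ ≤ η ^ 2 / 4 * Δ := by gcongr
  have hexp : Real.exp (-(η ^ 2 / 4 * Δ)) ≤ (δ / n) ^ 4 * (ε / (96 * K)) := calc
    _ ≤ Real.exp (-(4 * L + Q)) := Real.exp_le_exp.mpr (neg_le_neg hexponent)
    _ = (Real.exp (-L)) ^ 4 * Real.exp (-Q) := by
      rw [← Real.exp_nat_mul, ← Real.exp_add]
      push_cast
      ring_nf
    _ = (δ / n) ^ 4 * (ε / (96 * K)) := by
      rw [Real.exp_neg, Real.exp_neg, hL, hQ, Real.exp_log (by positivity),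
        Real.exp_log (by positivity), inv_div, inv_div]
  calc 3 * n * atypicalError n ε η Δ
      ≤ 3 * n * (16 * n ^ 3 * (K * ((δ / n) ^ 4 * (ε / (96 * K)))) / ε) := by
        rw [atypicalError]
        gcongr
    _ = δ ^ 4 / 2 := by field_simp; norm_num
    _ ≤ δ / 2 := by linarith [pow_le_of_le_one hδ.le hδ1 four_ne_zero]

lemma lt_one_and_degree_pos (hlam : 0 < lam) (hle : lam ≤ (1 - ε) * Real.exp 1 / Δ) :
    ε < 1 ∧ 0 < Δ := by
  have hpos := hlam.trans_le hle
  obtain rfl | hΔ := Δ.eq_zero_or_pos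
  · simp at hpos
  · rw [div_pos_iff_of_pos_right (Nat.cast_pos.mpr hΔ),
      mul_pos_iff_of_pos_right (Real.exp_pos 1)] at hpos
    exact ⟨sub_pos.mp hpos, hΔ⟩

end Parameters

theorem exists_dTV_annealing_le {ε : ℝ} (hε : 0 < ε) (hε1 : ε < 1) :
    ∃ C : ℝ, 0 < C ∧ ∀ {V : Type} [Fintype V] [DecidableEq V] [Nonempty V] {G : SimpleGraph V}
      [DecidableRel G.Adj] {Δ : ℕ} {δ lam : ℝ}, 0 < δ → G.IsRegularOfDegree Δ → 6 ≤ G.egirth →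
      C * Real.log (Fintype.card V / δ) ≤ Δ → (hlam : 0 < lam) →
      lam ≤ (1 - ε) * Real.exp 1 / Δ → ∀ T : ℕ,
      6 * Fintype.card V * Fintype.card V / δ * (1 - ε / (4 * Fintype.card V)) ^ T ≤ 1 →
      dTV (annealing G (fun j => j * lam / (3 * Fintype.card V : ℕ)) (fun _ => T)
        (3 * Fintype.card V)) (gibbsPMF G lam hlam.le) ≤ δ := by
  obtain ⟨κ, hκ, hgap⟩ := exists_twoStepGap hε hε1
  obtain ⟨η, hη, hη7, hηκ⟩ : ∃ η : ℝ, 0 < η ∧ 7 * η ≤ 1 ∧ 48 * η < κ :=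
    ⟨min (1 / 7) (κ / 49), by positivity, by linarith [min_le_left (1 / 7) (κ / 49)],
      by linarith [min_le_right (1 / 7) (κ / 49)]⟩
  refine ⟨degreeConstant ε η, degreeConstant_pos hε hε1 hη, ?_⟩
  intro V _ _ _ G _ Δ δ lam hδ hreg hg hΔ hlam hle T hT
  obtain hδ1 | hδ1 := le_total 1 δ
  · exact (dTV_le_one _ _).trans hδ1
  have hΔ1 : (1 : ℝ) ≤ Δ := Nat.one_le_cast.mpr (lt_one_and_degree_pos hlam hle).2
  have hn : 2 ≤ Fintype.card V := by
    have hdeg := G.degree_lt_card_verts (Classical.arbitrary V)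
    rw [hreg] at hdeg
    have : 1 ≤ Δ := Nat.one_le_cast.mp hΔ1
    lia
  have hc : lam * Δ ≤ (1 - ε) * Real.exp 1 := (le_div_iff₀ (by linarith)).mp hle
  have hc3 : lam * Δ ≤ 3 := by nlinarith [Real.exp_one_lt_d9, Real.exp_pos 1]
  have hlamη : lam ≤ η := by
    have hη3 := (div_le_iff₀ hη).mp (three_div_le_degree hε hε1 hη hn hδ hδ1 hΔ)
    exact le_of_mul_le_mul_right (by linarith) (by linarith : (0 : ℝ) < Δ)
  set n := Fintype.card V
  have hk0 : (0 : ℝ) < (3 * n : ℕ) := by positivity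
  have hstages : lam * n ≤ (3 * n : ℕ) := by
    push_cast
    gcongr
    nlinarith
  have hdist := dTV_annealing_le hg hreg hε hε1 hgap hη hη7 hηκ hlam.le hlamη hc T
    (Nat.cast_pos.mp hk0) hstages le_rfl
  simp only [mul_div_cancel_left₀ lam hk0.ne'] at hdist
  have hmix : 6 * n * n * (1 - ε / (4 * n)) ^ T ≤ δ := by
    rwa [div_mul_eq_mul_div, div_le_one hδ] at hT
  have hatypical := atypicalError_le hε hε1 hη hn hδ hδ1 hΔ
  push_cast at hdist ⊢
  linarith

end HardCore

/-- There are a program `P` and a polynomial `p` (both independent of all parameters) such that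
for every `ε > 0` there is `C > 0` with the following property for all `δ`, `G`, `lam`: on input
`(G, lam, δ, ε)` the program halts with certainty within `p(n, 1/ε, log⁺(1/δ))` steps; its output
has exactly the law of simulated annealing by Glauber dynamics along an increasing sequence of
fugacities from `0` to `lam`, in particular it is an independent set; and this law is within
total variation distance `δ` of the Gibbs distribution at fugacity `lam`. -/
theorem theorem1p5 :
    ∃ (P : RealRAM.Prog) (p : MvPolynomial (Fin 3) ℝ),
      ∀ ε : ℝ, 0 < ε → ∃ C : ℝ, 0 < C ∧
        ∀ δ : ℝ, 0 < δ →
        ∀ (n : ℕ) [NeZero n] (G : SimpleGraph (Fin n)) [DecidableRel G.Adj] (Δ : ℕ),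
          G.IsRegularOfDegree Δ → 6 ≤ G.egirth → C * Real.log (n / δ) ≤ Δ →
        ∀ lam : ℝ, 0 < lam → lam ≤ (1 - ε) * Real.exp 1 / Δ →
          ∃ (k : ℕ) (fug : ℕ → ℝ) (T : ℕ → ℕ) (t : ℕ),
            fug 0 = 0 ∧ (∀ i < k, fug i < fug (i + 1)) ∧ fug k = lam ∧
            (t : ℝ) ≤ MvPolynomial.eval ![(n : ℝ), 1 / ε, Real.posLog (1 / δ)] p ∧
            RealRAM.outputAfter P t G lam δ ε =
              (HardCore.annealing G fug T k).map (fun X => some X.1) ∧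
            HardCore.tvDist (fun X => (HardCore.annealing G fug T k X).toReal)
              (HardCore.gibbs G lam) ≤ δ := by
  refine ⟨RealRAM.annealProg, HardCore.runtimePoly, fun ε hε => ?_⟩
  obtain hε1 | hε1 := le_or_gt 1 ε
  · exact ⟨1, one_pos, fun _ _ _ _ _ _ _ _ _ _ _ hlam hle =>
      absurd (HardCore.lt_one_and_degree_pos hlam hle).1 hε1.not_gt⟩
  obtain ⟨C, hC, hdTV⟩ := HardCore.exists_dTV_annealing_le hε hε1
  refine ⟨C, hC, fun δ hδ n _ G _ Δ hreg hg hΔ lam hlam hle => ?_⟩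
  have hn : (1 : ℝ) ≤ n := Nat.one_le_cast.mpr (NeZero.pos n)
  have hk : (0 : ℝ) < (3 * n : ℕ) := by push_cast; linarith
  have hr : ε / (4 * n) < 1 := (div_lt_one (by linarith)).mpr (by linarith)
  obtain ⟨T, hT, hTle⟩ := HardCore.exists_stepCount (q := 6 * n * n / δ)
    (r := 1 - ε / (4 * n)) (sub_pos.mpr hr) (sub_lt_self 1 (by positivity)) (by positivity)
  have hcounter : 6 * n * n / δ * (1 - ε / (4 * n)) ^ T ≤ 1 :=
    not_lt.mp fun h => ((hT T le_rfl).mp h).false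
  refine ⟨3 * n, fun j => j * lam / (3 * n : ℕ), fun _ => T,
    ((14 * n + 20) * T + 18) * (3 * n) + 31, by simp, fun i _ => ?_,
    mul_div_cancel_left₀ lam hk.ne', HardCore.runtime_le_eval_runtimePoly hε hTle,
    RealRAM.outputAfter_annealProg hT, ?_⟩
  · exact div_lt_div_of_pos_right
      (mul_lt_mul_of_pos_right (Nat.cast_lt.mpr i.lt_succ_self) hlam) hk
  · simpa only [HardCore.dTV, HardCore.gibbsPMF_toReal, Fintype.card_fin] using
      hdTV hδ hreg hg (by rwa [Fintype.card_fin]) hlam hle T (by rwa [Fintype.card_fin])
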